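/- **Setting.** There are $N$ channels and $K$ secondary users, $1\le K\le N$, and time is slotted, $t=0,1,2,\dots$. In slot $t$ channel $n$ is idle ($S_{n,t}=1$) with probability $\mu_n$ and busy ($S_{n,t}=0$) otherwise. If a user senses channel $n$ in slot $t$, it detects it as idle ($X=1$) or busy ($X=0$) with the same error probabilities for all users (symmetric users): $\mathbb P(X=0\mid S_{n,t}=1)=\varepsilon_n$ (false alarm) and $\mathbb P(X=1\mid S_{n,t}=0)=\delta_n$ (miss detection). The channel states and the detection outcomes of slot $t$ are independent of everything that happened before slot $t$. User $k$, selecting channel $a^{(k)}_t$, gets the reward $r^{(k)}_t=S_{a^{(k)}_t,t}\,X^{(k)}_t$, so that channel $n$ has expected reward $\lambda_n=(1-\varepsilon_n)\mu_n$. **Policy.** All users share all rewards. Let $T_n(t)$ be the number of times channel $n$ was selected, by all users together, before slot $t$, let $\overline W_n(t)$ be the mean of the rewards so obtained, and let the common $UCB_1$ index be $$B_n(t)=\overline W_n(t)+\sqrt{\frac{\alpha\ln t}{T_n(t)}},\qquad B_n(t)=+\infty\ \text{ if }T_n(t)=0 .$$ At the beginning of every round of $K$ slots, i.e. at the times $t=Km$,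 $m=0,1,2,\dots$, the channels are ranked by decreasing $B_n(Km)$, ties being broken in any way that uses only the information available then. In each slot $t\in\{Km,\dots,Km+K-1\}$ user $k\in\{1,\dots,K\}$ selects the channel of rank $\big((k-1+t)\bmod K\big)+1$ (Round Robin coordination). **Regret.** Let $\mathcal D^*$ be the set of the $K$ channels with the highest expected rewards, and assume that it is uniquely determined, that is, $\lambda_n<\lambda_j$ for all $n\notin\mathcal D^*$, $j\in\mathcal D^*$. Put $$\bar\lambda^*=\frac1K\sum_{n\in\mathcal D^*}\lambda_n,\qquad \Delta_n=\min_{j\in\mathcal D^*}\lambda_j-\lambda_n .$$ The expected cumulative regret of user $k$ after $t$ slots is $$R^{(k)}_t=\sum_{m=0}^{t-1}\lambda^{*(k)}_m-\mathbb E\Big[\sum_{m=0}^{t-1}r^{(k)}_m\Big],$$ where $\lambda^{*(k)}_m$ is the expected reward of the channel that user $k$ is given in slot $m$ when the Round Robin coordination uses a ranking of the channels by their true expected rewards $\lambda_n$; thus user $k$ visits every channel of $\mathcal D^*$ once in each round, and the benchmark of a full round is $K\bar\lambda^*$. **Theorem 1 (Upper Bound of the Regret).** If $\alpha>1$, then for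 every user $k$, as $t\to\infty$, $$R^{(k)}_t\le\sum_{n\notin\mathcal D^*}\frac{4\alpha\,(\bar\lambda^*-\lambda_n)}{K\Delta_n^2}\,\ln(t+K-1)+o(\ln t).$$ The same bound holds for $t\,\bar\lambda^*-\mathbb E\big[\sum_{m=0}^{t-1}r^{(k)}_m\big]$, the regret against the mean reward $\bar\lambda^*$ in every slot. -/

import Mathlib

open MeasureTheory ProbabilityTheory Filter Asymptotics

namespace OSA

/-- `σ` ranks the channels by decreasing weight: `σ n` is the rank of channel `n`, rank `0` being
the best one. Ties may be broken in any way. -/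
def IsRanking {N : ℕ} {β : Type*} [LE β] (w : Fin N → β) (σ : Equiv.Perm (Fin N)) : Prop :=
  ∀ n n' : Fin N, σ n ≤ σ n' → w n' ≤ w n

/-- The channel that Round Robin gives to user `k` in slot `t` under the ranking `σ`: the one of
rank `(k + t) mod K` (users and ranks are counted from `0`). -/
def circular {N K : ℕ} (hKN : K ≤ N) (σ : Equiv.Perm (Fin N)) (k : Fin K) (t : ℕ) : Fin N :=
  σ.symm ⟨(k.val + t) % K, lt_of_lt_of_le (Nat.mod_lt _ k.pos) hKN⟩

section Policy

variable {Ω : Type*} {N K : ℕ}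

/-- The channel `a^{(k)}_t` selected by user `k` in slot `t`, when `σ m` is the common ranking used
in the `m`-th round, i.e. in the slots `K m, …, K m + K - 1`. -/
def action (hKN : K ≤ N) (σ : ℕ → Ω → Equiv.Perm (Fin N)) (k : Fin K) (t : ℕ) (ω : Ω) : Fin N :=
  circular hKN (σ (t / K) ω) k t

/-- The reward `r^{(k)}_t = S_{a,t} X^{(k)}_t` with `a = a^{(k)}_t`. Here `S n t` is the state of
channel `n` in slot `t` (`1` idle, `0` busy) and `Y k n t` is what user `k` detects in slot `t` if
it senses channel `n`, so that `X^{(k)}_t = Y k a t`. -/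
noncomputable def reward (S : Fin N → ℕ → Ω → Fin 2) (Y : Fin K → Fin N → ℕ → Ω → Fin 2)
    (hKN : K ≤ N) (σ : ℕ → Ω → Equiv.Perm (Fin N)) (k : Fin K) (t : ℕ) (ω : Ω) : ℝ :=
  ((S (action hKN σ k t ω) t ω).val : ℝ) * ((Y k (action hKN σ k t ω) t ω).val : ℝ)

/-- `T_n(t)`: how often channel `n` was selected, by all users together, in the slots before `t`. -/
def pulls (hKN : K ≤ N) (σ : ℕ → Ω → Equiv.Perm (Fin N)) (n : Fin N) (t : ℕ) (ω : Ω) : ℕ :=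
  ∑ m ∈ Finset.range t, ∑ k : Fin K, if action hKN σ k m ω = n then 1 else 0

/-- The mean of all the rewards that the users obtained on channel `n` before slot `t`
(meaningful if `T_n(t) > 0`). -/
noncomputable def sampleMean (S : Fin N → ℕ → Ω → Fin 2) (Y : Fin K → Fin N → ℕ → Ω → Fin 2)
    (hKN : K ≤ N) (σ : ℕ → Ω → Equiv.Perm (Fin N)) (n : Fin N) (t : ℕ) (ω : Ω) : ℝ :=
  (∑ m ∈ Finset.range t, ∑ k : Fin K,
    if action hKN σ k m ω = n then reward S Y hKN σ k m ω else 0) / (pulls hKN σ n t ω : ℝ)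

/-- The common `UCB₁` index of channel `n` at slot `t`, computed from the shared rewards. It is
infinite for a channel that nobody has tried yet. -/
noncomputable def ucbIndex (S : Fin N → ℕ → Ω → Fin 2) (Y : Fin K → Fin N → ℕ → Ω → Fin 2)
    (hKN : K ≤ N) (α : ℝ) (σ : ℕ → Ω → Equiv.Perm (Fin N)) (n : Fin N) (t : ℕ) (ω : Ω) : EReal :=
  if pulls hKN σ n t ω = 0 then ⊤
  else ((sampleMean S Y hKN σ n t ω
    + Real.sqrt (α * Real.log (t : ℝ) / (pulls hKN σ n t ω : ℝ)) : ℝ) : EReal)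

/-- The primary network with symmetric users. `ℱ t` is the information available before slot `t`;
what happens in slot `t` (channel states and detector outcomes) is independent of it. Channel `n`
is idle with probability `μ n`; each user has on it the false alarm probability `ε n` and the miss
detection probability `δ n`. The two conditional probabilities are written as joint ones, which
also covers `μ n = 0` and `μ n = 1`. No independence between the channels is required. -/
structure IsSymmetricNetwork {mΩ : MeasurableSpace Ω} (P : Measure Ω) (ℱ : Filtration ℕ mΩ)
    (S : Fin N → ℕ → Ω → Fin 2) (Y : Fin K → Fin N → ℕ → Ω → Fin 2)
    (μ ε δ : Fin N → ℝ) : Prop where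
  eps_mem : ∀ n, ε n ∈ Set.Icc (0 : ℝ) 1
  delta_mem : ∀ n, δ n ∈ Set.Icc (0 : ℝ) 1
  measurable_slot : ∀ t, Measurable[ℱ (t + 1)] fun ω =>
    ((fun n => S n t ω, fun k n => Y k n t ω) : (Fin N → Fin 2) × (Fin K → Fin N → Fin 2))
  indep_slot : ∀ t, Indep (MeasurableSpace.comap (fun ω =>
    ((fun n => S n t ω, fun k n => Y k n t ω) : (Fin N → Fin 2) × (Fin K → Fin N → Fin 2)))
    inferInstance) (ℱ t) P
  idle : ∀ n t, P.real {ω | S n t ω = 1} = μ n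
  false_alarm : ∀ k n t, P.real {ω | S n t ω = 1 ∧ Y k n t ω = 0} = ε n * μ n
  miss_detection : ∀ k n t, P.real {ω | S n t ω = 0 ∧ Y k n t ω = 1} = δ n * (1 - μ n)

/-- Round Robin coordination driven by the common `UCB₁` index: at the beginning of every round of
`K` slots the channels are ranked by their indices at that time. Ties may be broken in any way that
uses only the information available then. -/
structure IsRoundRobinUCB {mΩ : MeasurableSpace Ω} (ℱ : Filtration ℕ mΩ)
    (S : Fin N → ℕ → Ω → Fin 2) (Y : Fin K → Fin N → ℕ → Ω → Fin 2) (hKN : K ≤ N) (α : ℝ)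
    (σ : ℕ → Ω → Equiv.Perm (Fin N)) : Prop where
  adapted : ∀ (m : ℕ) (n : Fin N), Measurable[ℱ (K * m)] fun ω => σ m ω n
  ranking : ∀ (m : ℕ) (ω : Ω), IsRanking (fun n => ucbIndex S Y hKN α σ n (K * m) ω) (σ m ω)

/-- `E[W^{(k)}_t]`: the expected cumulated reward of user `k` in the first `t` slots. -/
noncomputable def expectedThroughput {mΩ : MeasurableSpace Ω} (P : Measure Ω)
    (S : Fin N → ℕ → Ω → Fin 2) (Y : Fin K → Fin N → ℕ → Ω → Fin 2)
    (hKN : K ≤ N) (σ : ℕ → Ω → Equiv.Perm (Fin N)) (k : Fin K) (t : ℕ) : ℝ :=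
  ∫ ω, ∑ m ∈ Finset.range t, reward S Y hKN σ k m ω ∂P

/-- The expected cumulated regret of user `k` after `t` slots. The benchmark in slot `m` is the
expected reward of the channel to which user `k` has access in that slot when the Round Robin
coordination is fed with the true expected rewards `lam`, ranked by `τ`. -/
noncomputable def regret {mΩ : MeasurableSpace Ω} (P : Measure Ω)
    (S : Fin N → ℕ → Ω → Fin 2) (Y : Fin K → Fin N → ℕ → Ω → Fin 2)
    (hKN : K ≤ N) (σ : ℕ → Ω → Equiv.Perm (Fin N)) (lam : Fin N → ℝ) (τ : Equiv.Perm (Fin N))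
    (k : Fin K) (t : ℕ) : ℝ :=
  (∑ m ∈ Finset.range t, lam (circular hKN τ k m)) - expectedThroughput P S Y hKN σ k t

end Policy

/-- The expected reward `(1 - ε n) μ n` of a channel. -/
def quality {N : ℕ} (μ ε : Fin N → ℝ) (n : Fin N) : ℝ := (1 - ε n) * μ n

/-- `D` is the set of the `K` best channels for the expected rewards `lam`. -/
def IsBestSet {N : ℕ} (lam : Fin N → ℝ) (K : ℕ) (D : Finset (Fin N)) : Prop :=
  D.card = K ∧ ∀ n ∉ D, ∀ j ∈ D, lam n < lam j

/-- The mean expected reward of the channels in `D`. -/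
noncomputable def meanQuality {N : ℕ} (lam : Fin N → ℝ) (D : Finset (Fin N)) : ℝ :=
  (∑ n ∈ D, lam n) / (D.card : ℝ)

/-- `Δ_n`: the smallest expected reward in `D` minus the expected reward of `n`. -/
noncomputable def gap {N : ℕ} (lam : Fin N → ℝ) (D : Finset (Fin N)) (n : Fin N) : ℝ :=
  (⨅ j : D, lam j) - lam n

/-- The leading term of the bound on the regret. -/
noncomputable def leadingTerm {N : ℕ} (lam : Fin N → ℝ) (D : Finset (Fin N)) (K : ℕ) (α : ℝ)
    (t : ℕ) : ℝ :=
  ∑ n ∈ Dᶜ, 4 * α * (meanQuality lam D - lam n) / ((K : ℝ) * gap lam D n ^ 2)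
    * Real.log ((t : ℝ) + (K : ℝ) - 1)

end OSA

/-! In each round, every channel of the current top set is selected once per slot, hence `K` times,
and each user visits it once. So one user's loss over the complete rounds is governed by the sets `A
i` of selected channels. Since `A i` and `D` have equal size, the mean `x` of the best set can be
subtracted from every quality: the loss of round `i` is the sum of `x - lam n` over wrongly selected
`n`, plus the sum of `lam j - x` over omitted `j ∈ D` (`IsBestSet.sum_sub_sum_le`). Omitted channels
with `lam j ≤ x` cost nothing.

Wrong selections obey the usual UCB argument. If the confidence bounds hold and `n ∉ D` is selected,
some `j ∈ D` is left out and its index is at most that of `n`; hence the gap is at most twice the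
bonus of `n`. This bounds the pulls of `n` by `4 α log / gap ^ 2`, and a visit costs `K` pulls,
whence the factor `1 / K` (`card_good_visits_le`). The confidence bounds fail in only boundedly many
rounds on average, because `α > 1`.

What remains is to show that omissions of a channel `j ∈ D` better than average contribute only
`o(log)`. Such a `j` strictly beats some `l ∈ D`. Almost surely `D` is selected in most rounds, and
whenever it is, the index of every `n ∉ D` is at most that of `l`, which is close to `lam l`.
Indices of well-sampled channels grow very little while the round number at most about doubles, so
`n` cannot overtake `j` before `D` is selected again (`eventually_mem_of_lt`). Thus omissions are
almost surely finite in number, while within the confidence bounds they are at most `C₁ log + C₂`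
for every outcome; dominated convergence gives `o(log)` in expectation
(`isLittleO_integral_omissionCount`). -/

namespace OSA

/-! ### Round Robin rotation and top sets -/

section Combinatorics

variable {N K : ℕ}

/-- The set of the channels of rank less than `K`. -/
def topSet (K : ℕ) (σ : Equiv.Perm (Fin N)) : Finset (Fin N) :=
  Finset.univ.filter fun n => (σ n).val < K

lemma mem_topSet {σ : Equiv.Perm (Fin N)} {n : Fin N} : n ∈ topSet K σ ↔ (σ n).val < K := by
  simp [topSet]

lemma sum_topSet (hKN : K ≤ N) (σ : Equiv.Perm (Fin N)) {M : Type*} [AddCommMonoid M]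
    (f : Fin N → M) :
    ∑ r : Fin K, f (σ.symm (Fin.castLE hKN r)) = ∑ n ∈ topSet K σ, f n := by
  refine Finset.sum_bij (fun r _ => σ.symm (Fin.castLE hKN r)) ?_ ?_ ?_ ?_
  · intro r _
    simp [mem_topSet]
  · intro r _ r' _ h
    simpa using h
  · intro n hn
    refine ⟨⟨(σ n).val, mem_topSet.1 hn⟩, Finset.mem_univ _, ?_⟩
    rw [Equiv.symm_apply_eq]
    rfl
  · intro r _
    rfl

lemma card_topSet (hKN : K ≤ N) (σ : Equiv.Perm (Fin N)) : (topSet K σ).card = K := by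
  have h := sum_topSet hKN σ (fun _ => (1 : ℕ))
  simpa using h.symm

/-- Rotation modulo `K` serves twice: over users in a fixed slot it excludes collisions, and over
the slots of a round it shows that a fixed user meets every top channel once. -/
lemma bijective_add_mod (t : ℕ) :
    Function.Bijective fun k : Fin K => (⟨(k.val + t) % K, Nat.mod_lt _ k.pos⟩ : Fin K) := by
  rw [← Finite.injective_iff_bijective]
  intro k k' h
  have h1 : (k.val + t) % K = (k'.val + t) % K := congrArg Fin.val h
  have h2 : k.val ≡ k'.val [MOD K] := Nat.ModEq.add_right_cancel' t h1
  exact Fin.ext (by rwa [Nat.ModEq, Nat.mod_eq_of_lt k.2, Nat.mod_eq_of_lt k'.2] at h2)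

lemma circular_eq_iff (hKN : K ≤ N) (σ : Equiv.Perm (Fin N)) (k : Fin K) (t : ℕ) (n : Fin N) :
    circular hKN σ k t = n ↔ (σ n).val = (k.val + t) % K := by
  unfold circular
  rw [Equiv.symm_apply_eq, Fin.ext_iff, eq_comm]

lemma circular_injective (hKN : K ≤ N) (σ : Equiv.Perm (Fin N)) (t : ℕ) :
    Function.Injective fun k : Fin K => circular hKN σ k t := by
  intro k k' h
  have h1 := σ.symm.injective h
  exact (bijective_add_mod t).1 (Fin.ext (by simpa only [Fin.mk.injEq] using h1))

lemma sum_circular_user (hKN : K ≤ N) (σ : Equiv.Perm (Fin N)) (t : ℕ) {M : Type*}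
    [AddCommMonoid M] (f : Fin N → M) :
    ∑ k : Fin K, f (circular hKN σ k t) = ∑ n ∈ topSet K σ, f n := by
  rw [← sum_topSet hKN]
  exact (bijective_add_mod t).sum_comp fun r : Fin K => f (σ.symm (Fin.castLE hKN r))

lemma sum_circular_slot (hKN : K ≤ N) (σ : Equiv.Perm (Fin N)) (k : Fin K) (i : ℕ) {M : Type*}
    [AddCommMonoid M] (f : Fin N → M) :
    ∑ s ∈ Finset.range K, f (circular hKN σ k (K * i + s)) = ∑ n ∈ topSet K σ, f n := by
  rw [← sum_topSet hKN, Finset.sum_range]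
  rw [← (bijective_add_mod (k.val + K * i)).sum_comp
    fun r : Fin K => f (σ.symm (Fin.castLE hKN r))]
  refine Finset.sum_congr rfl fun s _ => ?_
  unfold circular
  congr 2
  refine Fin.ext ?_
  change (k.val + (K * i + s.val)) % K = (s.val + (k.val + K * i)) % K
  congr 1
  ring

lemma sum_circular_rounds (hKN : K ≤ N) (σ : ℕ → Equiv.Perm (Fin N)) (k : Fin K) (q : ℕ)
    {M : Type*} [AddCommMonoid M] (f : Fin N → M) :
    ∑ t ∈ Finset.range (K * q), f (circular hKN (σ (t / K)) k t)
      = ∑ i ∈ Finset.range q, ∑ n ∈ topSet K (σ i), f n := by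
  induction q with
  | zero => simp
  | succ q ih =>
    rw [Finset.sum_range_succ, ← ih, Nat.mul_succ, Finset.sum_range_add]
    congr 1
    rw [← sum_circular_slot hKN (σ q) k q f]
    refine Finset.sum_congr rfl fun s hs => ?_
    rw [Nat.mul_add_div k.pos, Nat.div_eq_of_lt (Finset.mem_range.1 hs), Nat.add_zero]

/-- The number of the rounds before round `m` in which channel `n` is among the selected ones. -/
def visits (A : ℕ → Finset (Fin N)) (n : Fin N) (m : ℕ) : ℕ :=
  ((Finset.range m).filter fun i => n ∈ A i).card

lemma visits_succ (A : ℕ → Finset (Fin N)) (n : Fin N) (m : ℕ) :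
    visits A n (m + 1) = visits A n m + if n ∈ A m then 1 else 0 := by
  unfold visits
  rw [Finset.card_filter, Finset.card_filter, Finset.sum_range_succ]

lemma visits_mono (A : ℕ → Finset (Fin N)) (n : Fin N) : Monotone (visits A n) := by
  refine monotone_nat_of_le_succ fun m => ?_
  rw [visits_succ]
  exact Nat.le_add_right _ _

lemma exists_mem_notMem_of_card_eq {A D : Finset (Fin N)} (h : A.card = D.card) {j : Fin N}
    (hj : j ∈ D) (hjA : j ∉ A) : ∃ n ∈ A, n ∉ D := by
  by_contra! hc
  exact hjA (Finset.eq_of_subset_of_card_le hc h.ge ▸ hj)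

lemma IsRanking.le_of_mem_of_notMem {β : Type*} [LE β] {w : Fin N → β} {σ : Equiv.Perm (Fin N)}
    (h : IsRanking w σ) {n n' : Fin N} (hn : n ∈ topSet K σ) (hn' : n' ∉ topSet K σ) :
    w n' ≤ w n := by
  refine h n n' ?_
  rw [mem_topSet] at hn hn'
  rw [Fin.le_def]
  omega

lemma IsBestSet.topSet_eq {lam : Fin N → ℝ} {D : Finset (Fin N)} (hKN : K ≤ N)
    (hD : IsBestSet lam K D) {τ : Equiv.Perm (Fin N)} (hτ : IsRanking lam τ) :
    topSet K τ = D := by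
  have hc : (topSet K τ).card = D.card := by rw [card_topSet hKN, hD.1]
  refine (Finset.eq_of_subset_of_card_le (fun j hj => ?_) hc.le).symm
  by_contra hjA
  obtain ⟨n, hn, hnD⟩ := exists_mem_notMem_of_card_eq hc hj hjA
  exact absurd (hτ.le_of_mem_of_notMem hn hjA) (not_le.2 (hD.2 n hnD j hj))

end Combinatorics

/-! ### Counting selections -/

section Selection

variable {Ω : Type*} {N K : ℕ}

lemma sum_action_ite_one (hKN : K ≤ N) (σ : ℕ → Ω → Equiv.Perm (Fin N)) (n : Fin N) (t : ℕ)
    (ω : Ω) :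
    (∑ k : Fin K, if action hKN σ k t ω = n then 1 else 0)
      = if n ∈ topSet K (σ (t / K) ω) then 1 else 0 := by
  have h := sum_circular_user hKN (σ (t / K) ω) t (fun n' => if n' = n then 1 else 0)
  rw [Finset.sum_ite_eq'] at h
  exact h

lemma pulls_succ (hKN : K ≤ N) (σ : ℕ → Ω → Equiv.Perm (Fin N)) (n : Fin N) (t : ℕ) (ω : Ω) :
    pulls hKN σ n (t + 1) ω
      = pulls hKN σ n t ω + ∑ k : Fin K, if action hKN σ k t ω = n then 1 else 0 := by
  unfold pulls
  rw [Finset.sum_range_succ]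

lemma pulls_mono (hKN : K ≤ N) (σ : ℕ → Ω → Equiv.Perm (Fin N)) (n : Fin N) (ω : Ω) :
    Monotone fun t => pulls hKN σ n t ω := by
  refine monotone_nat_of_le_succ fun t => ?_
  rw [pulls_succ]
  exact Nat.le_add_right _ _

lemma pulls_le (hKN : K ≤ N) (σ : ℕ → Ω → Equiv.Perm (Fin N)) (n : Fin N) (t : ℕ) (ω : Ω) :
    pulls hKN σ n t ω ≤ t := by
  induction t with
  | zero => simp [pulls]
  | succ t ih =>
    rw [pulls_succ, sum_action_ite_one]
    split_ifs <;> omega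

/-- Exactly one user occupies a top channel in each of the `K` slots of a round. This is the source
of the factor `1 / K` in the regret bound. -/
lemma pulls_mul (hKN : K ≤ N) (hK : 0 < K) (σ : ℕ → Ω → Equiv.Perm (Fin N)) (n : Fin N) (m : ℕ)
    (ω : Ω) :
    pulls hKN σ n (K * m) ω = K * visits (fun i => topSet K (σ i ω)) n m := by
  induction m with
  | zero => simp [pulls, visits]
  | succ m ih =>
    rw [visits_succ, Nat.mul_add _ (visits _ _ _), ← ih, Nat.mul_succ]
    unfold pulls
    rw [Finset.sum_range_add]
    congr 1
    have : ∀ s ∈ Finset.range K,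
        (∑ k : Fin K, if action hKN σ k (K * m + s) ω = n then 1 else 0)
          = if n ∈ topSet K (σ m ω) then 1 else 0 := by
      intro s hs
      rw [sum_action_ite_one, Nat.mul_add_div hK, Nat.div_eq_of_lt (Finset.mem_range.1 hs),
        Nat.add_zero]
    rw [Finset.sum_congr rfl this]
    simp

end Selection

end OSA

namespace OSA

/-! ### Time-uniform Hoeffding bounds under adaptive selection -/

section Concentration

/-- One step of a multiplicative supermartingale. The past, `F`, decides which factor `ψ i` is
applied, and the factors are independent of the past; on each of the disjoint events `E i` the
integral therefore splits into a product. -/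
lemma lintegral_mul_le_of_indep_selection {Ω ι : Type*} [Fintype ι] {F G mΩ : MeasurableSpace Ω}
    {P : Measure Ω} (hF : F ≤ mΩ) (hG : G ≤ mΩ) (hind : Indep G F P) {E : ι → Set Ω}
    (hE : ∀ i, MeasurableSet[F] (E i)) (hdisj : ∀ ω i i', ω ∈ E i → ω ∈ E i' → i = i')
    {ψ : ι → Ω → ENNReal} (hψ : ∀ i, Measurable[G] (ψ i)) (hψ1 : ∀ i, ∫⁻ ω, ψ i ω ∂P ≤ 1)
    {V e : Ω → ENNReal} (hV : Measurable[F] V) (heE : ∀ ω i, ω ∈ E i → e ω = ψ i ω)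
    (he1 : ∀ ω, (∀ i, ω ∉ E i) → e ω = 1) :
    ∫⁻ ω, V ω * e ω ∂P ≤ ∫⁻ ω, V ω ∂P := by
  classical
  have hU : MeasurableSet[F] (⋃ i, E i)ᶜ := (MeasurableSet.iUnion hE).compl
  have hVE : ∀ i, Measurable[F] ((E i).indicator V) := fun i => hV.indicator (hE i)
  calc ∫⁻ ω, V ω * e ω ∂P
      ≤ ∫⁻ ω, ((⋃ i, E i)ᶜ.indicator V ω + ∑ i, (E i).indicator V ω * ψ i ω) ∂P := by
        refine lintegral_mono fun ω => ?_
        by_cases h : ∃ i, ω ∈ E i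
        · obtain ⟨i, hi⟩ := h
          rw [heE ω i hi]
          refine le_add_left ?_
          refine le_trans ?_ (Finset.single_le_sum (fun _ _ => zero_le) (Finset.mem_univ i))
          rw [Set.indicator_of_mem hi]
        · push Not at h
          rw [he1 ω h, mul_one]
          refine le_add_right ?_
          rw [Set.indicator_of_mem]
          simpa using h
    _ = ∫⁻ ω, (⋃ i, E i)ᶜ.indicator V ω ∂P
          + ∑ i, (∫⁻ ω, (E i).indicator V ω ∂P) * ∫⁻ ω, ψ i ω ∂P := by
        rw [lintegral_add_left ((hV.indicator hU).mono hF le_rfl), lintegral_finsetSum]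
        · congr 1
          refine Finset.sum_congr rfl fun i _ => ?_
          exact lintegral_mul_eq_lintegral_mul_lintegral_of_independent_measurableSpace hF hG
            hind.symm (hVE i) (hψ i)
        · exact fun i _ => ((hVE i).mono hF le_rfl).mul ((hψ i).mono hG le_rfl)
    _ ≤ ∫⁻ ω, (⋃ i, E i)ᶜ.indicator V ω ∂P + ∑ i, (∫⁻ ω, (E i).indicator V ω ∂P) := by
        gcongr with i
        exact mul_le_of_le_one_right zero_le (hψ1 i)
    _ = ∫⁻ ω, ((⋃ i, E i)ᶜ.indicator V ω + ∑ i, (E i).indicator V ω) ∂P := by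
        rw [lintegral_add_left ((hV.indicator hU).mono hF le_rfl), lintegral_finsetSum]
        exact fun i _ => (hVE i).mono hF le_rfl
    _ ≤ ∫⁻ ω, V ω ∂P := by
        refine lintegral_mono fun ω => ?_
        by_cases h : ∃ i, ω ∈ E i
        · obtain ⟨i, hi⟩ := h
          rw [Set.indicator_of_notMem (by simpa using ⟨i, hi⟩), zero_add,
            Finset.sum_eq_single i, Set.indicator_of_mem hi]
          · exact fun i' _ hne =>
              Set.indicator_of_notMem (fun hi' => hne (hdisj ω i' i hi' hi)) _
          · simp
        · push Not at h
          rw [Finset.sum_eq_zero fun i _ => Set.indicator_of_notMem (h i) _, add_zero]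
          exact Set.indicator_le_self' (fun _ _ => zero_le) ω

/-- Hoeffding's lemma: a variable with values in an interval of length one is sub-Gaussian with
variance proxy `1 / 4`, which gives the `h ^ 2 / 8`. -/
lemma lintegral_exp_bernoulli_le {Ω : Type*} {mΩ : MeasurableSpace Ω} {P : Measure Ω}
    [IsProbabilityMeasure P] {X : Ω → ℝ} (hX : Measurable X) (h01 : ∀ ω, X ω ∈ Set.Icc (0 : ℝ) 1)
    (h : ℝ) :
    ∫⁻ ω, ENNReal.ofReal (Real.exp (h * (X ω - ∫ ω', X ω' ∂P) - h ^ 2 / 8)) ∂P ≤ 1 := by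
  have hs := hasSubgaussianMGF_of_mem_Icc hX.aemeasurable (ae_of_all P h01)
  have hint := hs.integrable_exp_mul h
  have hm := hs.mgf_le h
  simp only [Real.exp_sub]
  rw [← ofReal_integral_eq_lintegral_ofReal (hint.div_const _)
    (ae_of_all _ fun ω => by positivity), integral_div]
  rw [← ENNReal.ofReal_one]
  refine ENNReal.ofReal_le_ofReal ?_
  rw [div_le_one (Real.exp_pos _)]
  refine hm.trans (Real.exp_le_exp.2 (le_of_eq ?_))
  simp
  ring

variable {Ω : Type*} {N K : ℕ} {mΩ : MeasurableSpace Ω} {P : Measure Ω} {ℱ : Filtration ℕ mΩ}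
  {S : Fin N → ℕ → Ω → Fin 2} {Y : Fin K → Fin N → ℕ → Ω → Fin 2} {μ ε δ : Fin N → ℝ}
  {hKN : K ≤ N} {α : ℝ} {σ : ℕ → Ω → Equiv.Perm (Fin N)}

/-- The σ-algebra generated by what happens in slot `t`. -/
@[reducible]
def slotSpace (S : Fin N → ℕ → Ω → Fin 2) (Y : Fin K → Fin N → ℕ → Ω → Fin 2) (t : ℕ) :
    MeasurableSpace Ω :=
  MeasurableSpace.comap (fun ω =>
    ((fun n => S n t ω, fun k n => Y k n t ω) : (Fin N → Fin 2) × (Fin K → Fin N → Fin 2)))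
    inferInstance

/-- The reward that user `k` would obtain on channel `n` in slot `t`. -/
def outcome (S : Fin N → ℕ → Ω → Fin 2) (Y : Fin K → Fin N → ℕ → Ω → Fin 2) (k : Fin K)
    (n : Fin N) (t : ℕ) (ω : Ω) : ℝ :=
  ((S n t ω).val : ℝ) * ((Y k n t ω).val : ℝ)

lemma reward_eq_outcome (k : Fin K) (t : ℕ) (ω : Ω) :
    reward S Y hKN σ k t ω = outcome S Y k (action hKN σ k t ω) t ω := rfl

lemma outcome_eq_indicator (k : Fin K) (n : Fin N) (t : ℕ) (ω : Ω) :
    outcome S Y k n t ω = {ω | S n t ω = 1 ∧ Y k n t ω = 1}.indicator (fun _ => (1 : ℝ)) ω := by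
  unfold outcome Set.indicator
  have h : S n t ω = 0 ∨ S n t ω = 1 := by omega
  have h' : Y k n t ω = 0 ∨ Y k n t ω = 1 := by omega
  rcases h with h | h <;> rcases h' with h' | h' <;> simp [h, h']

lemma outcome_mem_Icc (k : Fin K) (n : Fin N) (t : ℕ) (ω : Ω) :
    outcome S Y k n t ω ∈ Set.Icc (0 : ℝ) 1 := by
  rw [outcome_eq_indicator]
  unfold Set.indicator
  split_ifs <;> simp

lemma measurable_outcome_slotSpace (k : Fin K) (n : Fin N) (t : ℕ) :
    Measurable[slotSpace S Y t] (outcome S Y k n t) := by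
  have h : Measurable fun p : (Fin N → Fin 2) × (Fin K → Fin N → Fin 2) =>
      ((p.1 n).val : ℝ) * ((p.2 k n).val : ℝ) := measurable_of_finite _
  exact h.comp (comap_measurable _)

namespace IsSymmetricNetwork

lemma slotSpace_le (hnet : IsSymmetricNetwork P ℱ S Y μ ε δ) (t : ℕ) :
    slotSpace S Y t ≤ ℱ (t + 1) :=
  (hnet.measurable_slot t).comap_le

lemma measurable_outcome (hnet : IsSymmetricNetwork P ℱ S Y μ ε δ) (k : Fin K) (n : Fin N)
    (t : ℕ) : Measurable[ℱ (t + 1)] (outcome S Y k n t) :=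
  (measurable_outcome_slotSpace k n t).mono (hnet.slotSpace_le t) le_rfl

lemma integral_outcome [IsProbabilityMeasure P] (hnet : IsSymmetricNetwork P ℱ S Y μ ε δ)
    (k : Fin K) (n : Fin N) (t : ℕ) : ∫ ω, outcome S Y k n t ω ∂P = quality μ ε n := by
  have hmeas : ∀ p : (Fin N → Fin 2) × (Fin K → Fin N → Fin 2) → Prop,
      MeasurableSet {ω | p (fun n => S n t ω, fun k n => Y k n t ω)} := fun p =>
    ((hnet.measurable_slot t).mono (ℱ.le _) le_rfl) (Set.Finite.measurableSet (Set.toFinite {x | p x}))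
  have h11 : MeasurableSet {ω | S n t ω = 1 ∧ Y k n t ω = 1} :=
    hmeas fun p => p.1 n = 1 ∧ p.2 k n = 1
  have h10 : MeasurableSet {ω | S n t ω = 1 ∧ Y k n t ω = 0} :=
    hmeas fun p => p.1 n = 1 ∧ p.2 k n = 0
  have hd : Disjoint {ω | S n t ω = 1 ∧ Y k n t ω = 1} {ω | S n t ω = 1 ∧ Y k n t ω = 0} := by
    rw [Set.disjoint_left]
    rintro ω ⟨_, h1⟩ ⟨_, h0⟩
    rw [h1] at h0
    exact one_ne_zero h0
  have hu : {ω | S n t ω = 1 ∧ Y k n t ω = 1} ∪ {ω | S n t ω = 1 ∧ Y k n t ω = 0}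
      = {ω | S n t ω = 1} := by
    ext ω
    simp only [Set.mem_union, Set.mem_ofPred_eq, ← and_or_left]
    have : Y k n t ω = 1 ∨ Y k n t ω = 0 := by omega
    simp [this]
  have h := measureReal_union (μ := P) hd h10
  rw [hu, hnet.idle, hnet.false_alarm] at h
  simp only [outcome_eq_indicator]
  rw [integral_indicator h11, setIntegral_const, smul_eq_mul, mul_one]
  unfold quality
  linarith

lemma quality_mem_Icc [IsProbabilityMeasure P] (hnet : IsSymmetricNetwork P ℱ S Y μ ε δ)
    (n : Fin N) : quality μ ε n ∈ Set.Icc (0 : ℝ) 1 := by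
  have h : μ n ∈ Set.Icc (0 : ℝ) 1 := by
    rw [← hnet.idle n 0]
    exact ⟨measureReal_nonneg, measureReal_le_one⟩
  have he := hnet.eps_mem n
  exact ⟨mul_nonneg (by linarith [he.2]) h.1, mul_le_one₀ (by linarith [he.1]) h.1 h.2⟩

end IsSymmetricNetwork

lemma IsRoundRobinUCB.measurableSet_action (hpol : IsRoundRobinUCB ℱ S Y hKN α σ) (k : Fin K)
    (n : Fin N) (t : ℕ) : MeasurableSet[ℱ t] {ω | action hKN σ k t ω = n} := by
  have h : {ω | action hKN σ k t ω = n}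
      = (fun ω => σ (t / K) ω n) ⁻¹' {r | r.val = (k.val + t) % K} := by
    ext ω
    exact circular_eq_iff _ _ _ _ _
  rw [h]
  exact ((hpol.adapted (t / K) n).mono (ℱ.mono (Nat.mul_div_le t K)) le_rfl)
    (Set.Finite.measurableSet (Set.toFinite _))

lemma IsRoundRobinUCB.measurable_pulls (hpol : IsRoundRobinUCB ℱ S Y hKN α σ) (n : Fin N)
    (t : ℕ) : Measurable[ℱ t] (pulls hKN σ n t) := by
  unfold pulls
  refine Finset.measurable_sum _ fun m hm => Finset.measurable_sum _ fun k _ => ?_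
  exact Measurable.ite (ℱ.mono (Finset.mem_range.1 hm).le _ (hpol.measurableSet_action k n m))
    measurable_const measurable_const

/-- The sum, over the slots before `t`, of the deviations of the rewards obtained on channel `n`
from the value `x`. -/
noncomputable def deviation (S : Fin N → ℕ → Ω → Fin 2) (Y : Fin K → Fin N → ℕ → Ω → Fin 2)
    (hKN : K ≤ N) (σ : ℕ → Ω → Equiv.Perm (Fin N)) (x : ℝ) (n : Fin N) (t : ℕ) (ω : Ω) : ℝ :=
  ∑ m ∈ Finset.range t, ∑ k : Fin K,
    if action hKN σ k m ω = n then outcome S Y k n m ω - x else 0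

lemma sampleMean_sub (n : Fin N) (t : ℕ) (ω : Ω) (x : ℝ) (h : pulls hKN σ n t ω ≠ 0) :
    sampleMean S Y hKN σ n t ω - x
      = deviation S Y hKN σ x n t ω / (pulls hKN σ n t ω : ℝ) := by
  have h' : (pulls hKN σ n t ω : ℝ) ≠ 0 := Nat.cast_ne_zero.2 h
  unfold sampleMean
  rw [eq_div_iff h', sub_mul, div_mul_cancel₀ _ h']
  unfold deviation pulls
  push_cast
  rw [Finset.mul_sum, ← Finset.sum_sub_distrib]
  refine Finset.sum_congr rfl fun m _ => ?_
  rw [Finset.mul_sum, ← Finset.sum_sub_distrib]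
  refine Finset.sum_congr rfl fun k _ => ?_
  split_ifs with hn
  · rw [reward_eq_outcome, hn, mul_one]
  · simp

/-- The exponent of the Chernoff supermartingale of channel `n`, restricted to the first `s`
selections of that channel. -/
noncomputable def chernoffExponent (S : Fin N → ℕ → Ω → Fin 2)
    (Y : Fin K → Fin N → ℕ → Ω → Fin 2)
    (hKN : K ≤ N) (σ : ℕ → Ω → Equiv.Perm (Fin N)) (x h : ℝ) (s : ℕ) (n : Fin N) (t : ℕ)
    (ω : Ω) : ℝ :=
  ∑ m ∈ Finset.range t, ∑ k : Fin K,
    if action hKN σ k m ω = n ∧ pulls hKN σ n m ω < s then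
      h * (outcome S Y k n m ω - x) - h ^ 2 / 8 else 0

lemma IsRoundRobinUCB.measurableSet_selected (hpol : IsRoundRobinUCB ℱ S Y hKN α σ) (s : ℕ)
    (k : Fin K) (n : Fin N) (t : ℕ) :
    MeasurableSet[ℱ t] {ω | action hKN σ k t ω = n ∧ pulls hKN σ n t ω < s} :=
  (hpol.measurableSet_action k n t).inter
    ((hpol.measurable_pulls n t) (Set.to_countable (Set.Iio s)).measurableSet)

lemma measurable_chernoffExponent (hnet : IsSymmetricNetwork P ℱ S Y μ ε δ)
    (hpol : IsRoundRobinUCB ℱ S Y hKN α σ) (x h : ℝ) (s : ℕ) (n : Fin N) (t : ℕ) :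
    Measurable[ℱ t] (chernoffExponent S Y hKN σ x h s n t) := by
  unfold chernoffExponent
  refine Finset.measurable_sum _ fun m hm => Finset.measurable_sum _ fun k _ => ?_
  have hm' := Finset.mem_range.1 hm
  refine Measurable.ite (ℱ.mono hm'.le _ (hpol.measurableSet_selected s k n m)) ?_
    measurable_const
  have := (hnet.measurable_outcome k n m).mono (ℱ.mono hm') le_rfl
  exact ((this.sub_const x).const_mul h).sub_const _

/-- Induction on time. Users occupy distinct channels, so a slot adds at most one term to the
exponent; the past decides whether and through which user, and by Hoeffding's lemma the new factor
has mean at most one. -/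
lemma lintegral_exp_chernoffExponent_le [IsProbabilityMeasure P]
    (hnet : IsSymmetricNetwork P ℱ S Y μ ε δ) (hpol : IsRoundRobinUCB ℱ S Y hKN α σ) (h : ℝ)
    (s : ℕ) (n : Fin N) (t : ℕ) :
    ∫⁻ ω, ENNReal.ofReal (Real.exp (chernoffExponent S Y hKN σ (quality μ ε n) h s n t ω)) ∂P
      ≤ 1 := by
  induction t with
  | zero => simp [chernoffExponent]
  | succ t ih =>
    refine le_trans (le_of_eq_of_le ?_ (lintegral_mul_le_of_indep_selection (ℱ.le t)
      ((hnet.slotSpace_le t).trans (ℱ.le _)) (hnet.indep_slot t)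
      (E := fun k => {ω | action hKN σ k t ω = n ∧ pulls hKN σ n t ω < s})
      (ψ := fun k ω => ENNReal.ofReal
        (Real.exp (h * (outcome S Y k n t ω - quality μ ε n) - h ^ 2 / 8)))
      (e := fun ω => ENNReal.ofReal (Real.exp (∑ k : Fin K,
        if action hKN σ k t ω = n ∧ pulls hKN σ n t ω < s then
          h * (outcome S Y k n t ω - quality μ ε n) - h ^ 2 / 8 else 0)))
      (fun k => hpol.measurableSet_selected s k n t) ?_ ?_ ?_
      (Real.measurable_exp.comp
        (measurable_chernoffExponent hnet hpol (quality μ ε n) h s n t)).ennreal_ofReal ?_ ?_)) ih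
    · refine lintegral_congr fun ω => ?_
      rw [Function.comp_apply, ← ENNReal.ofReal_mul (Real.exp_pos _).le, ← Real.exp_add]
      unfold chernoffExponent
      rw [Finset.sum_range_succ]
    · rintro ω k k' ⟨hk, -⟩ ⟨hk', -⟩
      exact circular_injective hKN (σ (t / K) ω) t (hk.trans hk'.symm)
    · intro k
      have := measurable_outcome_slotSpace (S := S) (Y := Y) k n t
      exact (Real.measurable_exp.comp
        (((this.sub_const _).const_mul h).sub_const _)).ennreal_ofReal
    · intro k
      have := lintegral_exp_bernoulli_le (P := P)
        ((hnet.measurable_outcome k n t).mono (ℱ.le _) le_rfl) (outcome_mem_Icc k n t) h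
      rwa [hnet.integral_outcome] at this
    · rintro ω k ⟨hk, hs⟩
      rw [Finset.sum_eq_single k, if_pos ⟨hk, hs⟩]
      · intro k' _ hne
        refine if_neg fun hk' => hne ?_
        exact circular_injective hKN (σ (t / K) ω) t (hk'.1.trans hk.symm)
      · simp
    · intro ω hω
      have h0 : ∀ k, ¬(action hKN σ k t ω = n ∧ pulls hKN σ n t ω < s) := hω
      simp [h0]

lemma chernoffExponent_eq_of_pulls_le (x h : ℝ) (s : ℕ) (n : Fin N) (t : ℕ) (ω : Ω)
    (hs : pulls hKN σ n t ω ≤ s) :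
    chernoffExponent S Y hKN σ x h s n t ω
      = h * deviation S Y hKN σ x n t ω - pulls hKN σ n t ω * (h ^ 2 / 8) := by
  unfold chernoffExponent deviation
  have hp : (pulls hKN σ n t ω : ℝ) = ∑ m ∈ Finset.range t, ∑ k : Fin K,
      if action hKN σ k m ω = n then 1 else 0 := by
    unfold pulls
    push_cast
    rfl
  rw [hp, Finset.mul_sum, Finset.sum_mul, ← Finset.sum_sub_distrib]
  refine Finset.sum_congr rfl fun m hm => ?_
  rw [Finset.mul_sum, Finset.sum_mul, ← Finset.sum_sub_distrib]
  refine Finset.sum_congr rfl fun k _ => ?_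
  by_cases hn : action hKN σ k m ω = n
  · have h1 : pulls hKN σ n (m + 1) ω ≤ pulls hKN σ n t ω :=
      pulls_mono hKN σ n ω (Finset.mem_range.1 hm)
    have h2 : 1 ≤ ∑ k : Fin K, if action hKN σ k m ω = n then 1 else 0 := by
      refine le_trans ?_ (Finset.single_le_sum (fun _ _ => Nat.zero_le _) (Finset.mem_univ k))
      rw [if_pos hn]
    rw [pulls_succ] at h1
    rw [if_pos ⟨hn, by omega⟩, if_pos hn, if_pos hn, one_mul]
  · rw [if_neg (fun hc => hn hc.1), if_neg hn, if_neg hn]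
    ring

/-- The exponent freezes after `s` selections. A deviation at any time with count `s` can thus be
read off at one later deterministic time, without a union bound over time. -/
lemma chernoffExponent_eq_of_le_pulls (x h : ℝ) (s : ℕ) (n : Fin N) {t u : ℕ} (htu : t ≤ u)
    (ω : Ω) (hs : s ≤ pulls hKN σ n t ω) :
    chernoffExponent S Y hKN σ x h s n u ω = chernoffExponent S Y hKN σ x h s n t ω := by
  induction u, htu using Nat.le_induction with
  | base => rfl
  | succ u hu ih =>
    rw [← ih]
    unfold chernoffExponent
    rw [Finset.sum_range_succ, add_eq_left]
    refine Finset.sum_eq_zero fun k _ => if_neg fun hc => ?_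
    have : pulls hKN σ n t ω ≤ pulls hKN σ n u ω := pulls_mono hKN σ n ω hu
    omega

/-- Chernoff's bound, uniform in time, for the rewards obtained in the first `s` selections of
channel `n`. -/
lemma measure_exists_deviation_le [IsProbabilityMeasure P]
    (hnet : IsSymmetricNetwork P ℱ S Y μ ε δ) (hpol : IsRoundRobinUCB ℱ S Y hKN α σ) (h y : ℝ)
    (s : ℕ) (n : Fin N) :
    P {ω | ∃ t, pulls hKN σ n t ω = s ∧ y ≤ h * deviation S Y hKN σ (quality μ ε n) n t ω}
      ≤ ENNReal.ofReal (Real.exp (s * (h ^ 2 / 8) - y)) := by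
  have key : ∀ u, P {ω | ∃ t ≤ u, pulls hKN σ n t ω = s ∧
      y ≤ h * deviation S Y hKN σ (quality μ ε n) n t ω}
      ≤ ENNReal.ofReal (Real.exp (s * (h ^ 2 / 8) - y)) := by
    intro u
    -- Markov's inequality at the fixed time `u`.
    have hm := mul_meas_ge_le_lintegral (μ := P)
      ((Real.measurable_exp.comp ((measurable_chernoffExponent hnet hpol (quality μ ε n) h s n
        u).mono (ℱ.le u) le_rfl)).ennreal_ofReal) (ENNReal.ofReal (Real.exp (y - s * (h ^ 2 / 8))))
    have hle := hm.trans (lintegral_exp_chernoffExponent_le hnet hpol h s n u)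
    rw [mul_comm, ← ENNReal.le_div_iff_mul_le (by simp [Real.exp_pos]) (by simp), one_div,
      ← ENNReal.ofReal_inv_of_pos (Real.exp_pos _), ← Real.exp_neg, neg_sub] at hle
    refine (measure_mono ?_).trans hle
    rintro ω ⟨t, htu, hp, hy⟩
    refine ENNReal.ofReal_le_ofReal (Real.exp_le_exp.2 ?_)
    rw [chernoffExponent_eq_of_le_pulls _ _ _ _ htu ω hp.ge,
      chernoffExponent_eq_of_pulls_le _ _ _ _ _ ω hp.le, hp]
    linarith
  have hU : {ω | ∃ t, pulls hKN σ n t ω = s ∧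
      y ≤ h * deviation S Y hKN σ (quality μ ε n) n t ω}
      = ⋃ u, {ω | ∃ t ≤ u, pulls hKN σ n t ω = s ∧
      y ≤ h * deviation S Y hKN σ (quality μ ε n) n t ω} := by
    ext ω
    simp only [Set.mem_ofPred_eq, Set.mem_iUnion]
    constructor
    · rintro ⟨t, ht⟩
      exact ⟨t, t, le_rfl, ht⟩
    · rintro ⟨_, t, _, ht⟩
      exact ⟨t, ht⟩
  rw [hU, Monotone.measure_iUnion]
  · exact iSup_le key
  · rintro u v huv ω ⟨t, ht, h'⟩
    exact ⟨t, ht.trans huv, h'⟩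

/-- Hoeffding's bound, uniform in time, for the sample mean of `s` selections. -/
lemma measure_exists_abs_sampleMean_sub_le [IsProbabilityMeasure P]
    (hnet : IsSymmetricNetwork P ℱ S Y μ ε δ) (hpol : IsRoundRobinUCB ℱ S Y hKN α σ) {c : ℝ}
    (hc : 0 ≤ c) {s : ℕ} (hs : s ≠ 0) (n : Fin N) :
    P {ω | ∃ t, pulls hKN σ n t ω = s ∧ c ≤ |sampleMean S Y hKN σ n t ω - quality μ ε n|}
      ≤ 2 * ENNReal.ofReal (Real.exp (-(2 * s * c ^ 2))) := by
  -- For the level `s * c` of the deviation, `h = 4 * c` minimises the exponent `s * h ^ 2 / 8 - h *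
  -- s * c`; the opposite sign handles the lower tail.
  have h1 := measure_exists_deviation_le hnet hpol (4 * c) (4 * s * c ^ 2) s n
  have h2 := measure_exists_deviation_le hnet hpol (-(4 * c)) (4 * s * c ^ 2) s n
  have e1 : (s : ℝ) * ((4 * c) ^ 2 / 8) - 4 * s * c ^ 2 = -(2 * s * c ^ 2) := by ring
  have e2 : (s : ℝ) * ((-(4 * c)) ^ 2 / 8) - 4 * s * c ^ 2 = -(2 * s * c ^ 2) := by ring
  rw [e1] at h1
  rw [e2] at h2
  rw [two_mul]
  refine le_trans (measure_mono ?_) ((measure_union_le _ _).trans (add_le_add h1 h2))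
  rintro ω ⟨t, hp, hd⟩
  have hs' : (0 : ℝ) < s := by exact_mod_cast Nat.pos_of_ne_zero hs
  rw [sampleMean_sub n t ω _ (hp ▸ hs), hp, abs_div, abs_of_pos hs', le_div_iff₀ hs'] at hd
  rcases le_abs'.1 hd with h | h
  · right
    refine ⟨t, hp, ?_⟩
    nlinarith
  · left
    refine ⟨t, hp, ?_⟩
    nlinarith

end Concentration

end OSA

namespace OSA

/-! ### Pathwise analysis of the index policy -/

section Path

variable {N K : ℕ} {α : ℝ} {A : ℕ → Finset (Fin N)} {W : Fin N → ℕ → ℝ} {lam : Fin N → ℝ}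

/-- The exploration bonus of channel `n` at the beginning of round `m`. -/
noncomputable def radius (α : ℝ) (K : ℕ) (A : ℕ → Finset (Fin N)) (n : Fin N) (m : ℕ) : ℝ :=
  Real.sqrt (α * Real.log ((K * m : ℕ) : ℝ) / ((K * visits A n m : ℕ) : ℝ))

/-- The index of channel `n` at the beginning of round `m`, if `W` are the sample means. -/
noncomputable def roundIndex (α : ℝ) (K : ℕ) (A : ℕ → Finset (Fin N)) (W : Fin N → ℕ → ℝ)
    (n : Fin N) (m : ℕ) : EReal :=
  if visits A n m = 0 then ⊤ else ((W n m + radius α K A n m : ℝ) : EReal)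

/-- At the beginning of round `m` all the sample means are within their confidence bounds. -/
def IsGoodRound (α : ℝ) (K : ℕ) (A : ℕ → Finset (Fin N)) (W : Fin N → ℕ → ℝ) (lam : Fin N → ℝ)
    (m : ℕ) : Prop :=
  ∀ n, visits A n m ≠ 0 → |W n m - lam n| ≤ radius α K A n m

/-- In every round the channels of `A` have indices at least as large as those of the others. -/
def SelectsTop (α : ℝ) (K : ℕ) (A : ℕ → Finset (Fin N)) (W : Fin N → ℕ → ℝ) : Prop :=
  ∀ m n n', n ∈ A m → n' ∉ A m → roundIndex α K A W n' m ≤ roundIndex α K A W n m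

lemma radius_nonneg (n : Fin N) (m : ℕ) : 0 ≤ radius α K A n m := Real.sqrt_nonneg _

lemma radius_sq (hα : 0 ≤ α) (n : Fin N) (m : ℕ) :
    radius α K A n m ^ 2 = α * Real.log ((K * m : ℕ) : ℝ) / ((K * visits A n m : ℕ) : ℝ) :=
  Real.sq_sqrt (div_nonneg (mul_nonneg hα (Real.log_natCast_nonneg _)) (Nat.cast_nonneg _))

lemma visits_ne_zero_of_roundIndex_le {n : Fin N} {m : ℕ} {x : ℝ}
    (h : roundIndex α K A W n m ≤ (x : EReal)) : visits A n m ≠ 0 ∧ W n m + radius α K A n m ≤ x := by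
  unfold roundIndex at h
  split_ifs at h with hv
  · exact absurd h (not_le.2 (EReal.coe_lt_top x))
  · exact ⟨hv, EReal.coe_le_coe_iff.1 h⟩

lemma roundIndex_of_ne_zero {n : Fin N} {m : ℕ} (h : visits A n m ≠ 0) :
    roundIndex α K A W n m = ((W n m + radius α K A n m : ℝ) : EReal) := if_neg h

/-- The chain `lam j ≤ index j ≤ index n ≤ lam n + 2 * radius` forces `g ≤ 2 * radius`; solving for
the visits gives the constant `4`. -/
lemma visits_le_of_isGoodRound (hα : 0 ≤ α) (hK : 0 < K) (hsel : SelectsTop α K A W) {m : ℕ}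
    (hg : IsGoodRound α K A W lam m) {n j : Fin N} (hn : n ∈ A m) (hj : j ∉ A m) {g : ℝ}
    (hg0 : 0 < g) (hgap : lam n + g ≤ lam j) :
    (visits A n m : ℝ) ≤ 4 * α * Real.log ((K * m : ℕ) : ℝ) / (K * g ^ 2) := by
  have hK' : (0 : ℝ) < K := by exact_mod_cast hK
  rcases Nat.eq_zero_or_pos (visits A n m) with hv | hv
  · rw [hv, Nat.cast_zero]
    exact div_nonneg (mul_nonneg (by linarith) (Real.log_natCast_nonneg _)) (by positivity)
  have hle := hsel m n j hn hj
  rw [roundIndex_of_ne_zero hv.ne'] at hle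
  obtain ⟨hvj, hle⟩ := visits_ne_zero_of_roundIndex_le hle
  have h1 := abs_le.1 (hg n hv.ne')
  have h2 := abs_le.1 (hg j hvj)
  have h3 : g ≤ 2 * radius α K A n m := by linarith [h1.2, h2.1]
  have h4 : g ^ 2 ≤ 4 * radius α K A n m ^ 2 := by nlinarith
  have hv' : (0 : ℝ) < visits A n m := by exact_mod_cast hv
  rw [radius_sq hα, Nat.cast_mul K (visits A n m), ← mul_div_assoc, le_div_iff₀ (by positivity)] at h4
  rw [le_div_iff₀ (by positivity)]
  linarith

/-- Only the last counted round matters: the earlier ones are among the visits made before it, of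
which there are at most `L`. -/
lemma card_filter_mem_and_le (A : ℕ → Finset (Fin N)) (n : Fin N) (Q : ℕ → Prop)
    [DecidablePred Q] {L : ℝ} (hL : 0 ≤ L) (q : ℕ)
    (h : ∀ i < q, n ∈ A i → Q i → (visits A n i : ℝ) ≤ L) :
    (((Finset.range q).filter fun i => n ∈ A i ∧ Q i).card : ℝ) ≤ L + 1 := by
  induction q with
  | zero => simp; linarith
  | succ q ih =>
    rw [Finset.range_add_one, Finset.filter_insert]
    split_ifs with hq
    · rw [Finset.card_insert_of_notMem (by simp)]
      have h1 := h q (Nat.lt_succ_self q) hq.1 hq.2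
      have h2 : ((Finset.range q).filter fun i => n ∈ A i ∧ Q i).card ≤ visits A n q :=
        Finset.card_le_card (Finset.monotone_filter_right _ fun i _ hi => hi.1)
      have h3 : (((Finset.range q).filter fun i => n ∈ A i ∧ Q i).card : ℝ) ≤ visits A n q := by
        exact_mod_cast h2
      push_cast
      linarith
    · exact ih fun i hi => h i (hi.trans (Nat.lt_succ_self q))

lemma log_mul_mono {i q : ℕ} (hK : 0 < K) (h : i ≤ q) :
    Real.log ((K * i : ℕ) : ℝ) ≤ Real.log ((K * q : ℕ) : ℝ) := by
  rcases Nat.eq_zero_or_pos i with rfl | hi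
  · simpa using Real.log_natCast_nonneg (K * q)
  · refine Real.log_le_log (by exact_mod_cast Nat.mul_pos hK hi) ?_
    exact_mod_cast Nat.mul_le_mul_left K h

open Classical in
lemma card_good_visits_le (hα : 0 ≤ α) (hK : 0 < K) (hA : ∀ m, (A m).card = K)
    (hsel : SelectsTop α K A W) {D : Finset (Fin N)} (hD : D.card = K) {n : Fin N} (hn : n ∉ D)
    {g : ℝ} (hg0 : 0 < g) (hgap : ∀ j ∈ D, lam n + g ≤ lam j) (q : ℕ) :
    (((Finset.range q).filter fun i => n ∈ A i ∧ IsGoodRound α K A W lam i).card : ℝ)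
      ≤ 4 * α * Real.log ((K * q : ℕ) : ℝ) / (K * g ^ 2) + 1 := by
  have hK' : (0 : ℝ) < K := by exact_mod_cast hK
  refine card_filter_mem_and_le A n _
    (div_nonneg (mul_nonneg (by linarith) (Real.log_natCast_nonneg _)) (by positivity)) q ?_
  intro i hi hni hgi
  obtain ⟨j, hj, hjA⟩ := exists_mem_notMem_of_card_eq (hD.trans (hA i).symm) hni hn
  refine (visits_le_of_isGoodRound hα hK hsel hgi hni hjA hg0 (hgap j hj)).trans ?_
  have := log_mul_mono hK hi.le
  gcongr

open Classical in
lemma card_good_ne_le (hA : ∀ m, (A m).card = K) {D : Finset (Fin N)} (hD : D.card = K)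
    (Q : ℕ → Prop) (q : ℕ) :
    ((Finset.range q).filter fun i => A i ≠ D ∧ Q i).card
      ≤ ∑ n ∈ Dᶜ, ((Finset.range q).filter fun i => n ∈ A i ∧ Q i).card := by
  refine le_trans (Finset.card_le_card ?_) Finset.card_biUnion_le
  intro i hi
  rw [Finset.mem_filter] at hi
  rw [Finset.mem_biUnion]
  have : ¬ A i ⊆ D := fun h =>
    hi.2.1 (Finset.eq_of_subset_of_card_le h (hD.trans (hA i).symm).le)
  obtain ⟨n, hn, hnD⟩ := Finset.not_subset.1 this
  exact ⟨n, Finset.mem_compl.2 hnD, Finset.mem_filter.2 ⟨hi.1, hn, hi.2.2⟩⟩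

open Classical in
/-- The rounds with a wrong selection in which the confidence bounds hold are logarithmically
few. -/
lemma exists_card_good_ne_le (α : ℝ) (hα : 0 ≤ α) (hK : 0 < K) {D : Finset (Fin N)}
    (hD : IsBestSet lam K D) : ∃ C₁ C₂ : ℝ, 0 ≤ C₁ ∧ 0 ≤ C₂ ∧
      ∀ (A : ℕ → Finset (Fin N)) (W : Fin N → ℕ → ℝ), (∀ m, (A m).card = K) →
        SelectsTop α K A W → ∀ q,
        (((Finset.range q).filter fun i => A i ≠ D ∧ IsGoodRound α K A W lam i).card : ℝ)
          ≤ C₁ * Real.log ((K * q : ℕ) : ℝ) + C₂ := by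
  have hg : ∀ n, ∃ g : ℝ, 0 < g ∧ (n ∉ D → ∀ j ∈ D, lam n + g ≤ lam j) := by
    intro n
    by_cases hn : n ∈ D
    · exact ⟨1, one_pos, fun h => absurd hn h⟩
    have hDne : D.Nonempty := by rw [← Finset.card_pos, hD.1]; exact hK
    obtain ⟨l, hl, hmin⟩ := D.exists_min_image lam hDne
    refine ⟨lam l - lam n, sub_pos.2 (hD.2 n hn l hl), fun _ j hj => ?_⟩
    linarith [hmin j hj]
  choose g hg0 hgap using hg
  -- The constants are fixed before `A` and `W`, so they are the same for all outcomes; the later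
  -- domination relies on this.
  refine ⟨∑ n ∈ Dᶜ, 4 * α / (K * g n ^ 2), (Dᶜ.card : ℝ),
    Finset.sum_nonneg fun n _ => by have := hg0 n; positivity, Nat.cast_nonneg _, ?_⟩
  intro A W hA hsel q
  have h1 : (((Finset.range q).filter fun i => A i ≠ D ∧ IsGoodRound α K A W lam i).card : ℝ)
      ≤ ∑ n ∈ Dᶜ,
        (((Finset.range q).filter fun i => n ∈ A i ∧ IsGoodRound α K A W lam i).card : ℝ) := by
    exact_mod_cast card_good_ne_le hA hD.1 (IsGoodRound α K A W lam) q
  refine h1.trans ((Finset.sum_le_sum fun n hn => card_good_visits_le hα hK hA hsel hD.1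
    (Finset.mem_compl.1 hn) (hg0 n) (hgap n (Finset.mem_compl.1 hn)) q).trans (le_of_eq ?_))
  rw [Finset.sum_add_distrib, Finset.sum_mul]
  congr 1
  · exact Finset.sum_congr rfl fun n _ => by ring
  · simp

lemma eventually_log_add_le (hK : 0 < K) (C₁ C₂ : ℝ) {c : ℝ} (hc : 0 < c) :
    ∀ᶠ q : ℕ in atTop, C₁ * Real.log ((K * q : ℕ) : ℝ) + C₂ ≤ c * q := by
  have hK' : (0 : ℝ) < K := by exact_mod_cast hK
  have h1 : (fun x : ℝ => C₁ * Real.log x + C₂) =o[atTop] fun x : ℝ => x :=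
    (Real.isLittleO_log_id_atTop.const_mul_left C₁).add (isLittleO_const_id_atTop C₂)
  have h2 : Tendsto (fun q : ℕ => ((K * q : ℕ) : ℝ)) atTop atTop :=
    tendsto_natCast_atTop_atTop.comp (tendsto_id.const_mul_atTop' hK)
  filter_upwards [h2.eventually (h1.bound (div_pos hc hK'))] with q hq
  refine (le_abs_self _).trans (hq.trans (le_of_eq ?_))
  rw [Real.norm_of_nonneg (Nat.cast_nonneg _), Nat.cast_mul]
  field_simp

lemma tendsto_log_mul (hK : 0 < K) :
    Tendsto (fun q : ℕ => Real.log ((K * q : ℕ) : ℝ)) atTop atTop :=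
  Real.tendsto_log_atTop.comp
    (tendsto_natCast_atTop_atTop.comp (tendsto_id.const_mul_atTop' hK))

open Classical in
-- The finitely many rounds outside the confidence bounds only enlarge the additive constant.
lemma exists_card_ne_le (hα : 0 ≤ α) (hK : 0 < K) (hA : ∀ m, (A m).card = K)
    (hsel : SelectsTop α K A W) {D : Finset (Fin N)} (hD : IsBestSet lam K D)
    (hgood : ∀ᶠ m in atTop, IsGoodRound α K A W lam m) : ∃ C₁ C₂ : ℝ, ∀ q,
      (((Finset.range q).filter fun i => A i ≠ D).card : ℝ)
        ≤ C₁ * Real.log ((K * q : ℕ) : ℝ) + C₂ := by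
  obtain ⟨C₁, C₂, -, -, hC⟩ := exists_card_good_ne_le α hα hK hD
  obtain ⟨m₀, hm₀⟩ := eventually_atTop.1 hgood
  refine ⟨C₁, C₂ + m₀, fun q => ?_⟩
  have h : ((Finset.range q).filter fun i => A i ≠ D) ⊆
      ((Finset.range q).filter fun i => A i ≠ D ∧ IsGoodRound α K A W lam i)
        ∪ Finset.range m₀ := by
    intro i hi
    rw [Finset.mem_filter] at hi
    rw [Finset.mem_union, Finset.mem_filter]
    rcases lt_or_ge i m₀ with h | h
    · exact Or.inr (Finset.mem_range.2 h)
    · exact Or.inl ⟨hi.1, hi.2, hm₀ i h⟩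
  have h1 := (Finset.card_le_card h).trans (Finset.card_union_le _ _)
  rw [Finset.card_range] at h1
  have h2 : (((Finset.range q).filter fun i => A i ≠ D).card : ℝ)
      ≤ ((Finset.range q).filter fun i => A i ≠ D ∧ IsGoodRound α K A W lam i).card + m₀ := by
    exact_mod_cast h1
  linarith [hC A W hA hsel q]

/-- If the sample means converge and the confidence bounds hold eventually, then a channel of the
best set that is strictly better than another channel of that set is eventually always selected. -/
lemma eventually_mem_of_lt (hα : 0 < α) (hK : 0 < K) (hA : ∀ m, (A m).card = K)
    (hsel : SelectsTop α K A W) {D : Finset (Fin N)} (hD : IsBestSet lam K D)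
    (hW : ∀ n m, 0 ≤ W n m) (hlam : ∀ n, 0 ≤ lam n)
    (hgood : ∀ᶠ m in atTop, IsGoodRound α K A W lam m)
    (hconv : ∀ n, ∀ d > 0, ∃ s, ∀ m, s ≤ visits A n m → |W n m - lam n| < d) {l j : Fin N}
    (hl : l ∈ D) (hj : j ∈ D) (hlj : lam l < lam j) : ∀ᶠ m in atTop, j ∈ A m := by
  classical
  have hK' : (0 : ℝ) < K := by exact_mod_cast hK
  obtain ⟨C₁, C₂, hcard⟩ := exists_card_ne_le hα.le hK hA hsel hD hgood
  have hfew : ∀ᶠ q : ℕ in atTop,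
      (((Finset.range q).filter fun i => A i ≠ D).card : ℝ) ≤ 1 / 4 * q := by
    filter_upwards [eventually_log_add_le hK C₁ C₂ (by norm_num : (0 : ℝ) < 1 / 4)] with q hq
    exact (hcard q).trans hq
  have hmany : ∀ᶠ q : ℕ in atTop, ∀ i ∈ D, (q : ℝ) / 2 ≤ visits A i q := by
    filter_upwards [hfew] with q hq i hi
    have h1 : (Finset.range q).card ≤ visits A i q
        + ((Finset.range q).filter fun i => A i ≠ D).card := by
      rw [← Finset.card_filter_add_card_filter_not (s := Finset.range q) (fun m => i ∈ A m)]
      unfold visits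
      refine Nat.add_le_add_left (Finset.card_le_card ?_) _
      exact Finset.monotone_filter_right _ fun m _ hm h => hm (h ▸ hi)
    rw [Finset.card_range] at h1
    have h2 : (q : ℝ) ≤ visits A i q + ((Finset.range q).filter fun i => A i ≠ D).card := by
      exact_mod_cast h1
    linarith [(Nat.cast_nonneg q : (0 : ℝ) ≤ q)]
  -- Error budget: the index of `l` is within `2 * d` of `lam l`, the mean of `n` moves by less than
  -- `2 * d`, its bonus grows by at most `d`, and the mean of `j` errs by less than `d`. These six
  -- units exhaust the gap.
  set d : ℝ := (lam j - lam l) / 6 with hd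
  have hd0 : 0 < d := by rw [hd]; linarith
  choose s hs using fun n => hconv n d hd0
  have hclose : ∀ᶠ q : ℕ in atTop, ∀ i ∈ D, visits A i q ≠ 0 ∧ |W i q - lam i| < d := by
    have hlarge : ∀ᶠ q : ℕ in atTop, ∀ i : Fin N, (s i : ℝ) ≤ (q : ℝ) / 2 :=
      eventually_all.2 fun i =>
        (tendsto_natCast_atTop_atTop.atTop_div_const (by norm_num : (0 : ℝ) < 2)).eventually_ge_atTop
          _
    filter_upwards [hmany, hlarge, eventually_gt_atTop 0] with q hq hq' hq0 i hi
    have hq0' : (0 : ℝ) < q := by exact_mod_cast hq0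
    refine ⟨fun h => ?_, hs i q ?_⟩
    · have := hq i hi
      rw [h] at this
      push_cast at this
      linarith
    · exact_mod_cast (hq' i).trans (hq i hi)
  have hradl : ∀ᶠ q : ℕ in atTop, radius α K A l q ≤ d := by
    filter_upwards [hmany, eventually_log_add_le hK α 0
      (by positivity : (0 : ℝ) < d ^ 2 * K / 2), eventually_gt_atTop 0] with q hq hlog hq0
    have hq0' : (0 : ℝ) < q := by exact_mod_cast hq0
    have hv := hq l hl
    refine Real.sqrt_le_iff.2 ⟨hd0.le, ?_⟩
    rw [Nat.cast_mul K (visits A l q), div_le_iff₀ (mul_pos hK' (by linarith))]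
    have : d ^ 2 * (K * (q / 2)) ≤ d ^ 2 * (K * (visits A l q : ℝ)) := by gcongr
    linarith
  have hindexl : ∀ᶠ v : ℕ in atTop, roundIndex α K A W l v ≤ ((lam l + 2 * d : ℝ) : EReal) := by
    filter_upwards [hclose, hradl] with v hv hr
    rw [roundIndex_of_ne_zero (hv l hl).1, EReal.coe_le_coe_iff]
    linarith [(abs_lt.1 (hv l hl).2).2]
  set M : ℝ := lam l + 2 * d with hM
  have hM0 : 0 < M := by rw [hM]; linarith [hlam l]
  -- When `D` is selected, every outside index is at most that of `l`, hence at most `M`. As the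
  -- means are nonnegative, the bonus is then at most `M`, which forces at least `α log / (K M ^ 2)`
  -- visits: outside channels are sampled often enough for their means to be accurate.
  have hother : ∀ᶠ v : ℕ in atTop, ∀ n, A v = D → n ∉ D →
      s n ≤ visits A n v ∧ 2 * α ≤ d ^ 2 * (K * visits A n v) ∧ visits A n v ≠ 0 ∧
        W n v + radius α K A n v ≤ M := by
    refine eventually_all.2 fun n => ?_
    have ht := (tendsto_log_mul hK).eventually_ge_atTop
      (max (s n : ℝ) (2 * α / (d ^ 2 * K)) * (K * M ^ 2) / α)
    filter_upwards [hindexl, ht] with v hv hlog hAv hn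
    obtain ⟨h0, hle⟩ := visits_ne_zero_of_roundIndex_le
      ((hsel v l n (hAv ▸ hl) (hAv ▸ hn)).trans hv)
    have h0' : (0 : ℝ) < visits A n v := by exact_mod_cast Nat.pos_of_ne_zero h0
    have hr : radius α K A n v ^ 2 ≤ M ^ 2 := by
      have := hW n v
      have := radius_nonneg (α := α) (K := K) (A := A) n v
      gcongr
      linarith
    rw [radius_sq hα.le, Nat.cast_mul K (visits A n v), div_le_iff₀ (by positivity)] at hr
    rw [div_le_iff₀ hα] at hlog
    have hmax : max (s n : ℝ) (2 * α / (d ^ 2 * K)) ≤ visits A n v := by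
      refine le_of_mul_le_mul_right (hlog.trans ((mul_comm _ α).trans_le (hr.trans (le_of_eq ?_))))
        (by positivity : 0 < K * M ^ 2)
      ring
    refine ⟨by exact_mod_cast (le_max_left _ _).trans hmax, ?_, h0, hle⟩
    have := (le_max_right _ _).trans hmax
    rw [div_le_iff₀ (by positivity)] at this
    linarith
  obtain ⟨v₀, hv₀⟩ := eventually_atTop.1 hother
  filter_upwards [hfew, hclose, eventually_ge_atTop (2 * v₀ + 4)] with u hu hcu hu0
  by_contra hju
  obtain ⟨n, hnA, hnD⟩ := exists_mem_notMem_of_card_eq ((hA u).trans hD.1.symm) hj hju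
  -- At most a quarter of the first `u` rounds select another set, so these cannot fill the second
  -- half.
  obtain ⟨v, hvu, huv, hAv⟩ : ∃ v < u, u ≤ 2 * v + 1 ∧ A v = D := by
    by_contra! hc
    have hsub : Finset.Ico (u / 2) u ⊆ (Finset.range u).filter fun i => A i ≠ D := by
      intro i hi
      rw [Finset.mem_Ico] at hi
      exact Finset.mem_filter.2 ⟨Finset.mem_range.2 hi.2, hc i hi.2 (by omega)⟩
    have h1 := Finset.card_le_card hsub
    rw [Nat.card_Ico] at h1
    have h2 : 4 * (u - u / 2) ≤ u := by
      have h3 : ((u - u / 2 : ℕ) : ℝ) ≤ 1 / 4 * u := le_trans (by exact_mod_cast h1) hu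
      have h4 : 4 * ((u - u / 2 : ℕ) : ℝ) ≤ u := by linarith
      exact_mod_cast h4
    omega
  obtain ⟨hsv, hdv, hv0, hMv⟩ := hv₀ v (by omega) n hAv hnD
  have hmono := visits_mono A n hvu.le
  have hWv := (abs_lt.1 (hs n v hsv)).1
  have hWu := (abs_lt.1 (hs n u (hsv.trans hmono))).2
  have hr : radius α K A n u ≤ radius α K A n v + d := by
    refine Real.sqrt_le_iff.2 ⟨add_nonneg (radius_nonneg _ _) hd0.le, ?_⟩
    have h0' : (0 : ℝ) < visits A n v := by exact_mod_cast Nat.pos_of_ne_zero hv0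
    -- Since `v ≥ 1`, one has `u ≤ 2 * v + 1 ≤ 3 * v`, and `log 3 ≤ 2`.
    have hlog : Real.log ((K * u : ℕ) : ℝ) ≤ Real.log ((K * v : ℕ) : ℝ) + 2 := by
      have hKv : (0 : ℝ) < ((K * v : ℕ) : ℝ) := by
        exact_mod_cast Nat.mul_pos hK (by omega)
      have h3 : Real.log 3 ≤ 2 := by
        have := Real.log_le_sub_one_of_pos (by norm_num : (0 : ℝ) < 3)
        linarith
      have h4 : Real.log ((K * u : ℕ) : ℝ) ≤ Real.log (((K * v : ℕ) : ℝ) * 3) := by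
        refine Real.log_le_log (by exact_mod_cast Nat.mul_pos hK (by omega)) ?_
        have : K * u ≤ K * v * 3 := by
          rw [mul_assoc]
          exact Nat.mul_le_mul_left K (by omega)
        exact_mod_cast this
      rw [Real.log_mul hKv.ne' (by norm_num)] at h4
      linarith
    calc α * Real.log ((K * u : ℕ) : ℝ) / ((K * visits A n u : ℕ) : ℝ)
        ≤ α * (Real.log ((K * v : ℕ) : ℝ) + 2) / ((K * visits A n v : ℕ) : ℝ) := by
          have hlog0 := Real.log_natCast_nonneg (K * v)
          have : (0 : ℝ) < ((K * visits A n v : ℕ) : ℝ) := by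
            exact_mod_cast Nat.mul_pos hK (Nat.pos_of_ne_zero hv0)
          gcongr
      _ = radius α K A n v ^ 2 + 2 * α / (K * visits A n v) := by
          rw [radius_sq hα.le, Nat.cast_mul K (visits A n v)]
          ring
      _ ≤ radius α K A n v ^ 2 + d ^ 2 := by
          gcongr
          rw [div_le_iff₀ (by positivity)]
          exact hdv
      _ ≤ (radius α K A n v + d) ^ 2 := by
          nlinarith [mul_nonneg (radius_nonneg (α := α) (K := K) (A := A) n v) hd0.le]
  have hle := hsel u n j hnA hju
  rw [roundIndex_of_ne_zero (by omega : visits A n u ≠ 0), roundIndex_of_ne_zero (hcu j hj).1,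
    EReal.coe_le_coe_iff] at hle
  have hWj := (abs_lt.1 (hcu j hj).2).1
  have hrj := radius_nonneg (α := α) (K := K) (A := A) j u
  have : lam j - lam l = 6 * d := by rw [hd]; ring
  linarith

end Path

end OSA

namespace OSA

/-! ### Transfer to the random policy -/

section Rounds

variable {Ω : Type*} {N K : ℕ} {mΩ : MeasurableSpace Ω} {P : Measure Ω} {ℱ : Filtration ℕ mΩ}
  {S : Fin N → ℕ → Ω → Fin 2} {Y : Fin K → Fin N → ℕ → Ω → Fin 2} {μ ε δ : Fin N → ℝ}
  {hKN : K ≤ N} {α : ℝ} {σ : ℕ → Ω → Equiv.Perm (Fin N)}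

/-- The channels selected in round `i`. -/
def selection (K : ℕ) (σ : ℕ → Ω → Equiv.Perm (Fin N)) (ω : Ω) (i : ℕ) : Finset (Fin N) :=
  topSet K (σ i ω)

/-- The sample means at the beginning of the rounds. -/
noncomputable def roundMean (S : Fin N → ℕ → Ω → Fin 2) (Y : Fin K → Fin N → ℕ → Ω → Fin 2)
    (hKN : K ≤ N) (σ : ℕ → Ω → Equiv.Perm (Fin N)) (ω : Ω) (n : Fin N) (m : ℕ) : ℝ :=
  sampleMean S Y hKN σ n (K * m) ω

lemma pulls_round (hK : 0 < K) (n : Fin N) (m : ℕ) (ω : Ω) :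
    pulls hKN σ n (K * m) ω = K * visits (selection K σ ω) n m :=
  pulls_mul hKN hK σ n m ω

lemma IsRoundRobinUCB.selectsTop (hpol : IsRoundRobinUCB ℱ S Y hKN α σ) (hK : 0 < K) (ω : Ω) :
    SelectsTop α K (selection K σ ω) (roundMean S Y hKN σ ω) := by
  have h : ∀ n m, roundIndex α K (selection K σ ω) (roundMean S Y hKN σ ω) n m
      = ucbIndex S Y hKN α σ n (K * m) ω := by
    intro n m
    unfold roundIndex ucbIndex radius roundMean
    rw [pulls_round hK]
    simp [hK.ne']
  intro m n n' hn hn'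
  rw [h, h]
  exact (hpol.ranking m ω).le_of_mem_of_notMem hn hn'

lemma reward_nonneg (k : Fin K) (t : ℕ) (ω : Ω) : 0 ≤ reward S Y hKN σ k t ω :=
  (outcome_mem_Icc k _ t ω).1

lemma roundMean_nonneg (ω : Ω) (n : Fin N) (m : ℕ) : 0 ≤ roundMean S Y hKN σ ω n m := by
  refine div_nonneg (Finset.sum_nonneg fun _ _ => Finset.sum_nonneg fun _ _ => ?_)
    (Nat.cast_nonneg _)
  split_ifs
  exacts [reward_nonneg _ _ _, le_rfl]

/-- The confidence bounds hold at the beginning of round `m`. -/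
def confident (α : ℝ) (S : Fin N → ℕ → Ω → Fin 2) (Y : Fin K → Fin N → ℕ → Ω → Fin 2)
    (μ ε : Fin N → ℝ) (hKN : K ≤ N) (σ : ℕ → Ω → Equiv.Perm (Fin N)) (m : ℕ) : Set Ω :=
  {ω | IsGoodRound α K (selection K σ ω) (roundMean S Y hKN σ ω) (quality μ ε) m}

/-- A union bound over the channels and the possible counts `s ≤ K * m`. The bonus makes each
Hoeffding exponent equal to `-2 α log (K m)` whatever `s` is; the number of counts costs one power
of `K * m`, and `α > 1` keeps the result summable. -/
lemma measure_compl_confident_le [IsProbabilityMeasure P]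
    (hnet : IsSymmetricNetwork P ℱ S Y μ ε δ) (hpol : IsRoundRobinUCB ℱ S Y hKN α σ)
    (hα : 1 < α) (hK : 0 < K) (m : ℕ) :
    P (confident α S Y μ ε hKN σ m)ᶜ ≤ ENNReal.ofReal (2 * N * (m : ℝ) ^ (1 - 2 * α)) := by
  rcases Nat.eq_zero_or_pos m with rfl | hm
  -- No channel has been visited before round `0`, so its confidence bounds hold vacuously.
  · have : (confident α S Y μ ε hKN σ 0)ᶜ = ∅ := by
      rw [Set.compl_empty_iff, Set.eq_univ_iff_forall]
      intro ω n hn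
      exact absurd rfl hn
    simp [this]
  have hKm : (0 : ℝ) < ((K * m : ℕ) : ℝ) := by exact_mod_cast Nat.mul_pos hK hm
  set c : ℕ → ℝ := fun s => Real.sqrt (α * Real.log ((K * m : ℕ) : ℝ) / (s : ℝ))
  have hsub : (confident α S Y μ ε hKN σ m)ᶜ ⊆ ⋃ n ∈ (Finset.univ : Finset (Fin N)),
      ⋃ s ∈ Finset.Icc 1 (K * m), {ω | ∃ t, pulls hKN σ n t ω = s ∧
        c s ≤ |sampleMean S Y hKN σ n t ω - quality μ ε n|} := by
    intro ω hω
    have hω' : ¬ IsGoodRound α K (selection K σ ω) (roundMean S Y hKN σ ω) (quality μ ε) m := hω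
    unfold IsGoodRound at hω'
    push Not at hω'
    obtain ⟨n, hv, hlt⟩ := hω'
    simp only [Set.mem_iUnion]
    refine ⟨n, Finset.mem_univ n, K * visits (selection K σ ω) n m, ?_, K * m,
      pulls_round hK n m ω, hlt.le⟩
    have hle := pulls_le hKN σ n (K * m) ω
    rw [pulls_round hK] at hle
    exact Finset.mem_Icc.2 ⟨Nat.mul_pos hK (Nat.pos_of_ne_zero hv), hle⟩
  have hterm : ∀ n, ∀ s ∈ Finset.Icc 1 (K * m), P {ω | ∃ t, pulls hKN σ n t ω = s ∧
        c s ≤ |sampleMean S Y hKN σ n t ω - quality μ ε n|}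
        ≤ 2 * ENNReal.ofReal (((K * m : ℕ) : ℝ) ^ (-(2 * α))) := by
    intro n s hs
    have hs1 := (Finset.mem_Icc.1 hs).1
    refine (measure_exists_abs_sampleMean_sub_le hnet hpol (Real.sqrt_nonneg _) (by omega) n).trans
      (le_of_eq ?_)
    have hs' : (s : ℝ) ≠ 0 := by exact_mod_cast (by omega : s ≠ 0)
    rw [Real.sq_sqrt (div_nonneg (mul_nonneg (by linarith) (Real.log_natCast_nonneg _))
      (Nat.cast_nonneg _)), Real.rpow_def_of_pos hKm]
    congr 3
    field_simp
  calc P (confident α S Y μ ε hKN σ m)ᶜ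
      ≤ ∑ n : Fin N, ∑ s ∈ Finset.Icc 1 (K * m),
          2 * ENNReal.ofReal (((K * m : ℕ) : ℝ) ^ (-(2 * α))) :=
        (measure_mono hsub).trans ((measure_biUnion_finset_le _ _).trans
          (Finset.sum_le_sum fun n _ => (measure_biUnion_finset_le _ _).trans
            (Finset.sum_le_sum (hterm n))))
    _ = ENNReal.ofReal (2 * N * (((K * m : ℕ) : ℝ) * ((K * m : ℕ) : ℝ) ^ (-(2 * α)))) := by
        have h0 : 0 ≤ ((K * m : ℕ) : ℝ) ^ (-(2 * α)) := Real.rpow_nonneg hKm.le _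
        rw [Finset.sum_const, Finset.sum_const, Nat.card_Icc, Finset.card_univ, Fintype.card_fin,
          nsmul_eq_mul, nsmul_eq_mul, ENNReal.ofReal_mul (by positivity),
          ENNReal.ofReal_mul (by positivity), ENNReal.ofReal_mul (by positivity),
          ENNReal.ofReal_natCast, ENNReal.ofReal_natCast, Nat.add_sub_cancel]
        simp only [ENNReal.ofReal_ofNat]
        ring
    _ ≤ ENNReal.ofReal (2 * N * (m : ℝ) ^ (1 - 2 * α)) := by
        refine ENNReal.ofReal_le_ofReal (mul_le_mul_of_nonneg_left ?_ (by positivity))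
        have h1 : ((K * m : ℕ) : ℝ) * ((K * m : ℕ) : ℝ) ^ (-(2 * α))
            = ((K * m : ℕ) : ℝ) ^ (1 - 2 * α) := by
          rw [sub_eq_add_neg, Real.rpow_add hKm, Real.rpow_one]
        rw [h1]
        refine Real.rpow_le_rpow_of_nonpos (by exact_mod_cast hm) ?_ (by linarith)
        exact_mod_cast Nat.le_mul_of_pos_left m hK

lemma summable_confidence_bound (N : ℕ) (hα : 1 < α) :
    Summable fun m : ℕ => 2 * (N : ℝ) * (m : ℝ) ^ (1 - 2 * α) :=
  (Real.summable_nat_rpow.2 (by linarith)).mul_left _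

lemma ae_eventually_confident [IsProbabilityMeasure P]
    (hnet : IsSymmetricNetwork P ℱ S Y μ ε δ) (hpol : IsRoundRobinUCB ℱ S Y hKN α σ)
    (hα : 1 < α) (hK : 0 < K) :
    ∀ᵐ ω ∂P, ∀ᶠ m in atTop,
      IsGoodRound α K (selection K σ ω) (roundMean S Y hKN σ ω) (quality μ ε) m := by
  have hfin : ∑' m, P (confident α S Y μ ε hKN σ m)ᶜ ≠ ⊤ :=
    ne_top_of_le_ne_top (summable_confidence_bound N hα).tsum_ofReal_ne_top
      (ENNReal.tsum_le_tsum (measure_compl_confident_le hnet hpol hα hK))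
  filter_upwards [ae_eventually_notMem hfin] with ω hω
  filter_upwards [hω] with m hm
  exact not_not.1 hm

/-- A strong law indexed by the number of selections: the time-uniform Hoeffding bounds are summable
in that number, and Borel–Cantelli applies to the countably many precisions `1 / (p + 1)`. -/
lemma ae_sampleMean_tendsto [IsProbabilityMeasure P]
    (hnet : IsSymmetricNetwork P ℱ S Y μ ε δ) (hpol : IsRoundRobinUCB ℱ S Y hKN α σ) :
    ∀ᵐ ω ∂P, ∀ n, ∀ d > 0, ∃ s, ∀ t, s ≤ pulls hKN σ n t ω →
      |sampleMean S Y hKN σ n t ω - quality μ ε n| < d := by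
  have key : ∀ n, ∀ p : ℕ, ∀ᵐ ω ∂P, ∃ s, ∀ t, s ≤ pulls hKN σ n t ω →
      |sampleMean S Y hKN σ n t ω - quality μ ε n| < 1 / ((p : ℝ) + 1) := by
    intro n p
    set d : ℝ := 1 / ((p : ℝ) + 1) with hd
    have hd0 : 0 < d := Nat.one_div_pos_of_nat
    have hsum : Summable fun s : ℕ => 2 * Real.exp (-(2 * (s + 1 : ℕ) * d ^ 2)) := by
      have h1 : Summable fun s : ℕ => Real.exp (-(2 * d ^ 2)) ^ s :=
        summable_geometric_of_lt_one (Real.exp_pos _).le (Real.exp_lt_one_iff.2 (by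
          have := pow_pos hd0 2
          linarith))
      have h2 := ((summable_nat_add_iff 1).2 h1).mul_left 2
      refine h2.congr fun s => ?_
      rw [← Real.exp_nat_mul]
      congr 2
      ring
    have hfin : ∑' s : ℕ, P {ω | ∃ t, pulls hKN σ n t ω = s + 1 ∧
        d ≤ |sampleMean S Y hKN σ n t ω - quality μ ε n|} ≠ ⊤ := by
      refine ne_top_of_le_ne_top hsum.tsum_ofReal_ne_top (ENNReal.tsum_le_tsum fun s => ?_)
      refine (measure_exists_abs_sampleMean_sub_le hnet hpol hd0.le (Nat.succ_ne_zero s)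
        n).trans (le_of_eq ?_)
      rw [ENNReal.ofReal_mul (by norm_num), ENNReal.ofReal_ofNat]
    filter_upwards [ae_eventually_notMem hfin] with ω hω
    obtain ⟨s, hs⟩ := eventually_atTop.1 hω
    refine ⟨s + 1, fun t ht => ?_⟩
    by_contra hc
    exact hs (pulls hKN σ n t ω - 1) (by omega) ⟨t, by omega, not_lt.1 hc⟩
  filter_upwards [ae_all_iff.2 fun n => ae_all_iff.2 (key n)] with ω hω n d hd
  obtain ⟨p, hp⟩ := exists_nat_one_div_lt hd
  obtain ⟨s, hs⟩ := hω n p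
  exact ⟨s, fun t ht => (hs t ht).trans hp⟩

lemma ae_eventually_mem_selection [IsProbabilityMeasure P]
    (hnet : IsSymmetricNetwork P ℱ S Y μ ε δ) (hpol : IsRoundRobinUCB ℱ S Y hKN α σ)
    (hα : 1 < α) (hK : 0 < K) {D : Finset (Fin N)} (hD : IsBestSet (quality μ ε) K D)
    {l j : Fin N} (hl : l ∈ D) (hj : j ∈ D) (hlj : quality μ ε l < quality μ ε j) :
    ∀ᵐ ω ∂P, ∀ᶠ m in atTop, j ∈ selection K σ ω m := by
  filter_upwards [ae_eventually_confident hnet hpol hα hK, ae_sampleMean_tendsto hnet hpol]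
    with ω hgood hconv
  refine eventually_mem_of_lt (by linarith) hK (fun m => card_topSet hKN _)
    (hpol.selectsTop hK ω) hD (roundMean_nonneg ω) (fun n => (hnet.quality_mem_Icc n).1) hgood
    (fun n d hd => ?_) hl hj hlj
  obtain ⟨s, hs⟩ := hconv n d hd
  refine ⟨s, fun m hm => hs (K * m) ?_⟩
  rw [pulls_round hK]
  exact hm.trans (Nat.le_mul_of_pos_left _ hK)

lemma IsRoundRobinUCB.measurableSet_mem_selection (hpol : IsRoundRobinUCB ℱ S Y hKN α σ)
    (n : Fin N) (i : ℕ) : MeasurableSet {ω | n ∈ selection K σ ω i} := by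
  have h : {ω | n ∈ selection K σ ω i} = (fun ω => σ i ω n) ⁻¹' {r | r.val < K} := by
    ext ω
    exact mem_topSet
  rw [h]
  exact ((hpol.adapted i n).mono (ℱ.le _) le_rfl) (Set.Finite.measurableSet (Set.toFinite _))

lemma IsRoundRobinUCB.measurable_visits (hpol : IsRoundRobinUCB ℱ S Y hKN α σ) (n : Fin N)
    (m : ℕ) : Measurable fun ω => visits (selection K σ ω) n m := by
  unfold visits
  simp only [Finset.card_filter]
  exact Finset.measurable_sum _ fun i _ =>
    Measurable.ite (hpol.measurableSet_mem_selection n i) measurable_const measurable_const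

lemma sum_indicator_action (k : Fin K) (t : ℕ) (ω : Ω) (f : Fin N → ℝ) :
    ∑ n, {ω | action hKN σ k t ω = n}.indicator (fun _ => (1 : ℝ)) ω * f n
      = f (action hKN σ k t ω) := by
  simp [Set.indicator_apply]

lemma reward_eq_sum (k : Fin K) (t : ℕ) (ω : Ω) :
    reward S Y hKN σ k t ω
      = ∑ n, {ω | action hKN σ k t ω = n}.indicator (fun _ => (1 : ℝ)) ω * outcome S Y k n t ω := by
  rw [sum_indicator_action k t ω fun n => outcome S Y k n t ω, reward_eq_outcome]

lemma measurable_reward (hnet : IsSymmetricNetwork P ℱ S Y μ ε δ)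
    (hpol : IsRoundRobinUCB ℱ S Y hKN α σ) (k : Fin K) (t : ℕ) :
    Measurable (reward S Y hKN σ k t) := by
  have h : reward S Y hKN σ k t = fun ω => ∑ n,
      {ω | action hKN σ k t ω = n}.indicator (fun _ => (1 : ℝ)) ω * outcome S Y k n t ω :=
    funext (reward_eq_sum k t)
  rw [h]
  exact Finset.measurable_sum _ fun n _ =>
    (measurable_const.indicator (ℱ.le t _ (hpol.measurableSet_action k n t))).mul
      ((hnet.measurable_outcome k n t).mono (ℱ.le _) le_rfl)

lemma measurableSet_confident (hnet : IsSymmetricNetwork P ℱ S Y μ ε δ)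
    (hpol : IsRoundRobinUCB ℱ S Y hKN α σ) (m : ℕ) :
    MeasurableSet (confident α S Y μ ε hKN σ m) := by
  have h : confident α S Y μ ε hKN σ m = ⋂ n, {ω | visits (selection K σ ω) n m = 0} ∪
      {ω | |roundMean S Y hKN σ ω n m - quality μ ε n|
        ≤ radius α K (selection K σ ω) n m} := by
    ext ω
    rw [Set.mem_iInter]
    exact forall_congr' fun n => or_iff_not_imp_left.symm
  rw [h]
  refine MeasurableSet.iInter fun n => ((hpol.measurable_visits n m)
    (measurableSet_singleton 0)).union (measurableSet_le ?_ ?_)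
  · have h1 : Measurable fun ω => roundMean S Y hKN σ ω n m := by
      unfold roundMean sampleMean
      refine Measurable.div ?_ ?_
      · exact Finset.measurable_sum _ fun t _ => Finset.measurable_sum _ fun k _ =>
          Measurable.ite (ℱ.le t _ (hpol.measurableSet_action k n t))
            (measurable_reward hnet hpol k t) measurable_const
      · exact measurable_from_top.comp ((hpol.measurable_pulls n (K * m)).mono (ℱ.le _) le_rfl)
    exact (h1.sub_const _).abs
  · unfold radius
    exact Real.continuous_sqrt.measurable.comp (measurable_const.div
      ((measurable_from_top (f := fun v : ℕ => ((K * v : ℕ) : ℝ))).comp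
        (hpol.measurable_visits n m)))

/-- The choice in slot `t` is known beforehand and the outcome of the slot is independent of it, so
each term of the sum over channels factors. -/
lemma integral_reward [IsProbabilityMeasure P] (hnet : IsSymmetricNetwork P ℱ S Y μ ε δ)
    (hpol : IsRoundRobinUCB ℱ S Y hKN α σ) (k : Fin K) (t : ℕ) :
    ∫ ω, reward S Y hKN σ k t ω ∂P = ∫ ω, quality μ ε (action hKN σ k t ω) ∂P := by
  have hm : ∀ n, Measurable[ℱ t]
      ({ω | action hKN σ k t ω = n}.indicator (fun _ => (1 : ℝ))) := fun n =>
    measurable_const.indicator (hpol.measurableSet_action k n t)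
  have hm' : ∀ n, Measurable ({ω | action hKN σ k t ω = n}.indicator (fun _ => (1 : ℝ))) :=
    fun n => (hm n).mono (ℱ.le t) le_rfl
  have ho : ∀ n, Measurable (outcome S Y k n t) := fun n =>
    (hnet.measurable_outcome k n t).mono (ℱ.le _) le_rfl
  have hi : ∀ n, Integrable ({ω | action hKN σ k t ω = n}.indicator (fun _ => (1 : ℝ))) P :=
    fun n => (integrable_const 1).indicator (ℱ.le t _ (hpol.measurableSet_action k n t))
  have h1 : ∀ ω, quality μ ε (action hKN σ k t ω) = ∑ n,
      {ω | action hKN σ k t ω = n}.indicator (fun _ => (1 : ℝ)) ω * quality μ ε n :=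
    fun ω => (sum_indicator_action k t ω _).symm
  simp only [reward_eq_sum, h1]
  rw [integral_finsetSum, integral_finsetSum]
  · refine Finset.sum_congr rfl fun n _ => ?_
    have hind : IndepFun ({ω | action hKN σ k t ω = n}.indicator (fun _ => (1 : ℝ)))
        (outcome S Y k n t) P := by
      refine indep_of_indep_of_le_left (indep_of_indep_of_le_right (hnet.indep_slot t).symm ?_) ?_
      · exact (measurable_outcome_slotSpace k n t).comap_le
      · exact (hm n).comap_le
    rw [hind.integral_fun_mul_eq_mul_integral (hm' n).aestronglyMeasurable
      (ho n).aestronglyMeasurable, hnet.integral_outcome, integral_mul_const]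
  · exact fun n _ => (hi n).mul_const _
  · intro n _
    refine (hi n).mul_bdd (c := 1) (ho n).aestronglyMeasurable (ae_of_all _ fun ω => ?_)
    rw [Real.norm_of_nonneg (outcome_mem_Icc k n t ω).1]
    exact (outcome_mem_Icc k n t ω).2

lemma integrable_reward [IsProbabilityMeasure P] (hnet : IsSymmetricNetwork P ℱ S Y μ ε δ)
    (hpol : IsRoundRobinUCB ℱ S Y hKN α σ) (k : Fin K) (t : ℕ) :
    Integrable (reward S Y hKN σ k t) P :=
  Integrable.of_mem_Icc 0 1 (measurable_reward hnet hpol k t).aemeasurable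
    (ae_of_all _ fun ω => outcome_mem_Icc k _ t ω)

/-- The expected throughput dominates the expected rewards of the channels selected in the complete
rounds. -/
lemma integral_sum_selection_le [IsProbabilityMeasure P]
    (hnet : IsSymmetricNetwork P ℱ S Y μ ε δ) (hpol : IsRoundRobinUCB ℱ S Y hKN α σ) (k : Fin K)
    (t : ℕ) :
    ∫ ω, ∑ i ∈ Finset.range (t / K), ∑ n ∈ selection K σ ω i, quality μ ε n ∂P
      ≤ expectedThroughput P S Y hKN σ k t := by
  have h1 : expectedThroughput P S Y hKN σ k (K * (t / K))
      = ∫ ω, ∑ i ∈ Finset.range (t / K), ∑ n ∈ selection K σ ω i, quality μ ε n ∂P := by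
    unfold expectedThroughput
    rw [integral_finsetSum _ fun m _ => integrable_reward hnet hpol k m]
    simp only [integral_reward hnet hpol]
    rw [← integral_finsetSum]
    · refine integral_congr_ae (ae_of_all _ fun ω => ?_)
      exact sum_circular_rounds hKN (fun i => σ i ω) k (t / K) (quality μ ε)
    · intro m _
      refine Integrable.of_mem_Icc 0 1 (Measurable.aemeasurable ?_)
        (ae_of_all _ fun ω => hnet.quality_mem_Icc _)
      refine (measurable_of_finite (quality μ ε)).comp (measurable_to_countable' fun n => ?_)
      exact ℱ.le m _ (hpol.measurableSet_action k n m)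
  -- Dropping the slots of the incomplete round only lowers the throughput, because rewards are
  -- nonnegative.
  rw [← h1]
  unfold expectedThroughput
  refine integral_mono (integrable_finsetSum _ fun m _ => integrable_reward hnet hpol k m)
    (integrable_finsetSum _ fun m _ => integrable_reward hnet hpol k m) fun ω => ?_
  exact Finset.sum_le_sum_of_subset_of_nonneg (Finset.range_mono (Nat.mul_div_le t K))
    fun _ _ _ => reward_nonneg _ _ _

end Rounds

end OSA

namespace OSA

/-! ### Decomposition of the loss of a round -/

section Loss

variable {N K : ℕ} {α : ℝ} {A : ℕ → Finset (Fin N)} {W : Fin N → ℕ → ℝ} {lam : Fin N → ℝ}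
  {D : Finset (Fin N)}

lemma IsBestSet.nonempty (hD : IsBestSet lam K D) (hK : 0 < K) : D.Nonempty := by
  rw [← Finset.card_pos, hD.1]
  exact hK

lemma IsBestSet.mul_meanQuality (hD : IsBestSet lam K D) (hK : 0 < K) :
    (K : ℝ) * meanQuality lam D = ∑ n ∈ D, lam n := by
  have : (K : ℝ) ≠ 0 := by exact_mod_cast hK.ne'
  unfold meanQuality
  rw [hD.1, mul_div_cancel₀ _ this]

lemma IsBestSet.le_meanQuality (hD : IsBestSet lam K D) (hK : 0 < K) {x : ℝ}
    (h : ∀ j ∈ D, x ≤ lam j) : x ≤ meanQuality lam D := by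
  have hK' : (0 : ℝ) < K := by exact_mod_cast hK
  refine le_of_mul_le_mul_left ?_ hK'
  rw [hD.mul_meanQuality hK, ← nsmul_eq_mul, ← hD.1]
  exact Finset.card_nsmul_le_sum D lam x h

lemma IsBestSet.meanQuality_le (hD : IsBestSet lam K D) (hK : 0 < K) {x : ℝ}
    (h : ∀ j ∈ D, lam j ≤ x) : meanQuality lam D ≤ x := by
  have hK' : (0 : ℝ) < K := by exact_mod_cast hK
  refine le_of_mul_le_mul_left ?_ hK'
  rw [hD.mul_meanQuality hK, ← nsmul_eq_mul, ← hD.1]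
  exact Finset.sum_le_card_nsmul D lam x h

lemma gap_add_le (lam : Fin N → ℝ) (n : Fin N) {j : Fin N} (hj : j ∈ D) :
    lam n + gap lam D n ≤ lam j := by
  have h := ciInf_le (Set.finite_range fun i : D => lam i).bddBelow ⟨j, hj⟩
  unfold gap
  linarith

lemma IsBestSet.gap_pos (hD : IsBestSet lam K D) (hK : 0 < K) {n : Fin N} (hn : n ∉ D) :
    0 < gap lam D n := by
  obtain ⟨l, hl, hmin⟩ := D.exists_min_image lam (hD.nonempty hK)
  have : Nonempty D := ⟨⟨l, hl⟩⟩
  have h : lam l ≤ ⨅ i : D, lam i := le_ciInf fun i => hmin i i.2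
  have := hD.2 n hn l hl
  unfold gap
  linarith

open Classical in
/-- The loss of a round in terms of the wrong selections and of the omissions of the channels that
are better than the average of the best set. -/
lemma IsBestSet.sum_sub_sum_le (hD : IsBestSet lam K D) (hK : 0 < K)
    (h01 : ∀ n, lam n ∈ Set.Icc (0 : ℝ) 1) {B : Finset (Fin N)} (hB : B.card = K) :
    ∑ n ∈ D, lam n - ∑ n ∈ B, lam n
      ≤ ∑ n ∈ Dᶜ, (if n ∈ B then meanQuality lam D - lam n else 0)
        + ∑ j ∈ D.filter (fun j => meanQuality lam D < lam j), if j ∉ B then 1 else 0 := by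
  set x := meanQuality lam D with hx
  have hx0 : 0 ≤ x := hD.le_meanQuality hK fun j _ => (h01 j).1
  -- Centring at `x` changes nothing, because `D` and `B` have the same number of elements.
  have h1 : ∑ n ∈ D, lam n - ∑ n ∈ B, lam n
      = ∑ n, ((if n ∈ D then lam n - x else 0) - if n ∈ B then lam n - x else 0) := by
    rw [Finset.sum_sub_distrib, Finset.sum_ite_mem, Finset.sum_ite_mem, Finset.univ_inter,
      Finset.univ_inter, Finset.sum_sub_distrib, Finset.sum_sub_distrib]
    simp [hD.1, hB]
  rw [h1, ← Finset.sum_compl_add_sum D, Finset.sum_filter]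
  refine add_le_add (Finset.sum_le_sum fun n hn => ?_) (Finset.sum_le_sum fun j hj => ?_)
  · rw [if_neg (Finset.mem_compl.1 hn)]
    split_ifs <;> linarith
  · rw [if_pos hj]
    have := (h01 j).2
    split_ifs <;> linarith

open Classical in
-- A round outside the confidence bounds costs at most `K`, as qualities lie in `[0, 1]`; the other
-- rounds are decomposed around the mean of the best set, and their wrong selections are counted by
-- `card_good_visits_le`.
lemma IsBestSet.sum_loss_le (hD : IsBestSet lam K D) (hα : 0 ≤ α) (hK : 0 < K)
    (h01 : ∀ n, lam n ∈ Set.Icc (0 : ℝ) 1) (hA : ∀ m, (A m).card = K)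
    (hsel : SelectsTop α K A W) (q : ℕ) :
    ∑ i ∈ Finset.range q, (∑ n ∈ D, lam n - ∑ n ∈ A i, lam n)
      ≤ K * ∑ i ∈ Finset.range q, (if ¬ IsGoodRound α K A W lam i then 1 else 0)
        + ∑ n ∈ Dᶜ, (meanQuality lam D - lam n)
          * (4 * α * Real.log ((K * q : ℕ) : ℝ) / (K * gap lam D n ^ 2) + 1)
        + ∑ j ∈ D.filter (fun j => meanQuality lam D < lam j), ∑ i ∈ Finset.range q,
          if j ∉ A i ∧ IsGoodRound α K A W lam i then 1 else 0 := by
  set x := meanQuality lam D with hx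
  have hround : ∀ i, ∑ n ∈ D, lam n - ∑ n ∈ A i, lam n
      ≤ K * (if ¬ IsGoodRound α K A W lam i then 1 else 0)
        + ∑ n ∈ Dᶜ, (x - lam n) * (if n ∈ A i ∧ IsGoodRound α K A W lam i then 1 else 0)
        + ∑ j ∈ D.filter (fun j => x < lam j),
          if j ∉ A i ∧ IsGoodRound α K A W lam i then 1 else 0 := by
    intro i
    by_cases hg : IsGoodRound α K A W lam i
    · refine (hD.sum_sub_sum_le hK h01 (hA i)).trans (le_of_eq ?_)
      simp [hg, hx]
    · have h1 : ∑ n ∈ D, lam n ≤ K := by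
        have := Finset.sum_le_card_nsmul D lam 1 fun n _ => (h01 n).2
        simpa [hD.1] using this
      have h2 : 0 ≤ ∑ n ∈ A i, lam n := Finset.sum_nonneg fun n _ => (h01 n).1
      simp only [hg, and_false, not_false_eq_true, if_true, if_false, mul_zero,
        Finset.sum_const_zero]
      linarith
  refine (Finset.sum_le_sum fun i _ => hround i).trans ?_
  rw [Finset.sum_add_distrib, Finset.sum_add_distrib, ← Finset.mul_sum, Finset.sum_comm (t := Dᶜ),
    Finset.sum_comm (t := D.filter _)]
  gcongr with n hn
  have hnD := Finset.mem_compl.1 hn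
  rw [← Finset.mul_sum]
  refine mul_le_mul_of_nonneg_left ?_
    (sub_nonneg.2 (hD.le_meanQuality hK fun j hj => (hD.2 n hnD j hj).le))
  rw [Finset.sum_boole]
  exact card_good_visits_le hα hK hA hsel hD.1 hnD (hD.gap_pos hK hnD)
    (fun j hj => gap_add_le lam n hj) q

end Loss

/-! ### Expected counts and the regret bound -/

section Main

variable {Ω : Type*} {N K : ℕ} {mΩ : MeasurableSpace Ω} {P : Measure Ω} {ℱ : Filtration ℕ mΩ}
  {S : Fin N → ℕ → Ω → Fin 2} {Y : Fin K → Fin N → ℕ → Ω → Fin 2} {μ ε δ : Fin N → ℝ}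
  {hKN : K ≤ N} {α : ℝ} {σ : ℕ → Ω → Equiv.Perm (Fin N)} {D : Finset (Fin N)}

/-- The number of the rounds before round `q` in which a confidence bound fails. -/
noncomputable def failureCount (α : ℝ) (S : Fin N → ℕ → Ω → Fin 2)
    (Y : Fin K → Fin N → ℕ → Ω → Fin 2) (μ ε : Fin N → ℝ) (hKN : K ≤ N)
    (σ : ℕ → Ω → Equiv.Perm (Fin N)) (q : ℕ) (ω : Ω) : ℝ :=
  ∑ i ∈ Finset.range q, (confident α S Y μ ε hKN σ i)ᶜ.indicator (fun _ => (1 : ℝ)) ω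

/-- The number of the rounds before round `q` in which the confidence bounds hold and channel `j`
is not selected. -/
noncomputable def omissionCount (α : ℝ) (S : Fin N → ℕ → Ω → Fin 2)
    (Y : Fin K → Fin N → ℕ → Ω → Fin 2) (μ ε : Fin N → ℝ) (hKN : K ≤ N)
    (σ : ℕ → Ω → Equiv.Perm (Fin N)) (j : Fin N) (q : ℕ) (ω : Ω) : ℝ :=
  ∑ i ∈ Finset.range q, ({ω | j ∈ selection K σ ω i}ᶜ ∩ confident α S Y μ ε hKN σ i).indicator
    (fun _ => (1 : ℝ)) ω

lemma integrable_failureCount [IsProbabilityMeasure P] (hnet : IsSymmetricNetwork P ℱ S Y μ ε δ)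
    (hpol : IsRoundRobinUCB ℱ S Y hKN α σ) (q : ℕ) :
    Integrable (failureCount α S Y μ ε hKN σ q) P :=
  integrable_finsetSum _ fun i _ =>
    (integrable_const 1).indicator (measurableSet_confident hnet hpol i).compl

lemma integrable_omissionCount [IsProbabilityMeasure P] (hnet : IsSymmetricNetwork P ℱ S Y μ ε δ)
    (hpol : IsRoundRobinUCB ℱ S Y hKN α σ) (j : Fin N) (q : ℕ) :
    Integrable (omissionCount α S Y μ ε hKN σ j q) P :=
  integrable_finsetSum _ fun i _ => (integrable_const 1).indicator
    ((hpol.measurableSet_mem_selection j i).compl.inter (measurableSet_confident hnet hpol i))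

lemma integral_failureCount_le [IsProbabilityMeasure P]
    (hnet : IsSymmetricNetwork P ℱ S Y μ ε δ) (hpol : IsRoundRobinUCB ℱ S Y hKN α σ)
    (hα : 1 < α) (hK : 0 < K) (q : ℕ) :
    ∫ ω, failureCount α S Y μ ε hKN σ q ω ∂P ≤ ∑' m : ℕ, 2 * (N : ℝ) * (m : ℝ) ^ (1 - 2 * α) := by
  have hpos : ∀ m : ℕ, 0 ≤ 2 * (N : ℝ) * (m : ℝ) ^ (1 - 2 * α) := fun m => by positivity
  have hm := fun i => (measurableSet_confident hnet hpol i).compl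
  unfold failureCount
  rw [integral_finsetSum _ fun i _ => (integrable_const 1).indicator (hm i)]
  refine le_trans (Finset.sum_le_sum fun i _ => ?_)
    ((summable_confidence_bound N hα).sum_le_tsum (Finset.range q) fun m _ => hpos m)
  rw [integral_indicator (hm i), setIntegral_const, smul_eq_mul, mul_one]
  exact ENNReal.toReal_le_of_le_ofReal (hpos i) (measure_compl_confident_le hnet hpol hα hK i)

lemma omissionCount_nonneg (j : Fin N) (q : ℕ) (ω : Ω) :
    0 ≤ omissionCount α S Y μ ε hKN σ j q ω :=
  Finset.sum_nonneg fun _ _ => Set.indicator_nonneg (fun _ _ => zero_le_one) _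

/-- Omitting a channel of `D` means that the selected set is not `D`. Because `omissionCount` counts
only rounds within the confidence bounds, the logarithmic bound holds for every outcome and provides
the dominating constant below. -/
lemma exists_omissionCount_le (hpol : IsRoundRobinUCB ℱ S Y hKN α σ) (hα : 1 < α) (hK : 0 < K)
    (hD : IsBestSet (quality μ ε) K D) : ∃ C₁ C₂ : ℝ, 0 ≤ C₁ ∧ 0 ≤ C₂ ∧ ∀ j ∈ D, ∀ q ω,
      omissionCount α S Y μ ε hKN σ j q ω ≤ C₁ * Real.log ((K * q : ℕ) : ℝ) + C₂ := by
  classical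
  obtain ⟨C₁, C₂, h1, h2, h⟩ := exists_card_good_ne_le α (by linarith) hK hD
  refine ⟨C₁, C₂, h1, h2, fun j hj q ω => ?_⟩
  refine le_trans ?_ (h (selection K σ ω) (roundMean S Y hKN σ ω) (fun m => card_topSet hKN _)
    (hpol.selectsTop hK ω) q)
  rw [Finset.card_filter, Nat.cast_sum]
  refine Finset.sum_le_sum fun i _ => ?_
  push_cast
  by_cases hi : ω ∈ {ω | j ∈ selection K σ ω i}ᶜ ∩ confident α S Y μ ε hKN σ i
  · have hne : selection K σ ω i ≠ D := fun he => hi.1 (he.symm ▸ hj : j ∈ selection K σ ω i)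
    rw [Set.indicator_of_mem hi, if_pos ⟨hne, hi.2⟩]
  · rw [Set.indicator_of_notMem hi]
    split_ifs <;> norm_num

/-- Almost surely the count is eventually constant in `q`, so its quotient by the logarithm tends to
zero; the quotient is eventually at most `C₁ + C₂`, and dominated convergence passes to
expectations. -/
lemma isLittleO_integral_omissionCount [IsProbabilityMeasure P]
    (hnet : IsSymmetricNetwork P ℱ S Y μ ε δ) (hpol : IsRoundRobinUCB ℱ S Y hKN α σ)
    (hα : 1 < α) (hK : 0 < K) (hD : IsBestSet (quality μ ε) K D) {j : Fin N} (hj : j ∈ D)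
    (hjm : meanQuality (quality μ ε) D < quality μ ε j) :
    (fun q => ∫ ω, omissionCount α S Y μ ε hKN σ j q ω ∂P)
      =o[atTop] fun q : ℕ => Real.log ((K * q : ℕ) : ℝ) := by
  -- A channel above the mean of `D` cannot be a worst one of `D`.
  obtain ⟨l, hl, hlj⟩ : ∃ l ∈ D, quality μ ε l < quality μ ε j := by
    by_contra! hc
    exact absurd (hD.le_meanQuality hK hc) (not_le.2 hjm)
  have hlog1 : ∀ᶠ q : ℕ in atTop, 1 ≤ Real.log ((K * q : ℕ) : ℝ) :=
    (tendsto_log_mul hK).eventually_ge_atTop 1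
  obtain ⟨C₁, C₂, h1, h2, hC⟩ := exists_omissionCount_le hpol hα hK hD
  rw [isLittleO_iff_tendsto' (hlog1.mono fun q hq h0 => by linarith)]
  simp only [← integral_div]
  rw [← integral_zero Ω ℝ (μ := P)]
  refine tendsto_integral_filter_of_dominated_convergence (fun _ => C₁ + C₂) ?_ ?_
    (integrable_const _) ?_
  · exact Eventually.of_forall fun q =>
      ((integrable_omissionCount hnet hpol j q).div_const _).aestronglyMeasurable
  · filter_upwards [hlog1] with q hq
    refine ae_of_all _ fun ω => ?_
    have hq0 : 0 < Real.log ((K * q : ℕ) : ℝ) := by linarith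
    rw [Real.norm_of_nonneg (div_nonneg (omissionCount_nonneg j q ω) hq0.le), div_le_iff₀ hq0]
    nlinarith [hC j hj q ω]
  · filter_upwards [ae_eventually_mem_selection hnet hpol hα hK hD hl hj hlj] with ω hω
    obtain ⟨m₀, hm₀⟩ := eventually_atTop.1 hω
    have hconst : ∀ᶠ q in atTop, omissionCount α S Y μ ε hKN σ j m₀ ω
        = omissionCount α S Y μ ε hKN σ j q ω := by
      filter_upwards [eventually_ge_atTop m₀] with q hq
      refine Finset.sum_subset (Finset.range_mono hq) fun i _ hi => ?_
      refine Set.indicator_of_notMem (fun h => h.1 ?_) _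
      exact hm₀ i (not_lt.1 fun h => hi (Finset.mem_range.2 h))
    refine Tendsto.congr' ?_ ((tendsto_log_mul hK).const_div_atTop
      (omissionCount α S Y μ ε hKN σ j m₀ ω))
    filter_upwards [hconst] with q hq
    rw [hq]

lemma integral_loss_le [IsProbabilityMeasure P]
    (hnet : IsSymmetricNetwork P ℱ S Y μ ε δ) (hpol : IsRoundRobinUCB ℱ S Y hKN α σ)
    (hα : 1 < α) (hK : 0 < K) (hD : IsBestSet (quality μ ε) K D) (k : Fin K) (t : ℕ) :
    ((t / K : ℕ) : ℝ) * ∑ n ∈ D, quality μ ε n - expectedThroughput P S Y hKN σ k t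
      ≤ K * ∑' m : ℕ, 2 * (N : ℝ) * (m : ℝ) ^ (1 - 2 * α)
        + ∑ n ∈ Dᶜ, (meanQuality (quality μ ε) D - quality μ ε n)
          * (4 * α * Real.log ((K * (t / K) : ℕ) : ℝ) / (K * gap (quality μ ε) D n ^ 2) + 1)
        + ∑ j ∈ D.filter (fun j => meanQuality (quality μ ε) D < quality μ ε j),
          ∫ ω, omissionCount α S Y μ ε hKN σ j (t / K) ω ∂P := by
  classical
  set q := t / K with hq
  set c := ∑ n ∈ Dᶜ, (meanQuality (quality μ ε) D - quality μ ε n)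
          * (4 * α * Real.log ((K * q : ℕ) : ℝ) / (K * gap (quality μ ε) D n ^ 2) + 1) with hc
  have hpt : ∀ ω, (q : ℝ) * ∑ n ∈ D, quality μ ε n
      - ∑ i ∈ Finset.range q, ∑ n ∈ selection K σ ω i, quality μ ε n
      ≤ K * failureCount α S Y μ ε hKN σ q ω + c
        + ∑ j ∈ D.filter (fun j => meanQuality (quality μ ε) D < quality μ ε j),
          omissionCount α S Y μ ε hKN σ j q ω := by
    intro ω
    have h := hD.sum_loss_le (A := selection K σ ω) (W := roundMean S Y hKN σ ω)
      (by linarith : 0 ≤ α) hK hnet.quality_mem_Icc (fun m => card_topSet hKN _)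
      (hpol.selectsTop hK ω) q
    rw [Finset.sum_sub_distrib, Finset.sum_const, Finset.card_range, nsmul_eq_mul] at h
    simp only [failureCount, omissionCount, Set.indicator_apply, confident, Set.mem_compl_iff,
      Set.mem_inter_iff, Set.mem_ofPred_eq]
    convert h
  have hmeas : Integrable (fun ω =>
      ∑ i ∈ Finset.range q, ∑ n ∈ selection K σ ω i, quality μ ε n) P := by
    have : ∀ ω, ∑ i ∈ Finset.range q, ∑ n ∈ selection K σ ω i, quality μ ε n
        = ∑ i ∈ Finset.range q, ∑ n,
          {ω | n ∈ selection K σ ω i}.indicator (fun _ => quality μ ε n) ω := by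
      intro ω
      refine Finset.sum_congr rfl fun i _ => ?_
      simp only [Set.indicator_apply, Set.mem_ofPred_eq]
      rw [Finset.sum_ite_mem, Finset.univ_inter]
    simp only [this]
    exact integrable_finsetSum _ fun i _ => integrable_finsetSum _ fun n _ =>
      (integrable_const _).indicator (hpol.measurableSet_mem_selection n i)
  have hf := (integrable_failureCount hnet hpol q).const_mul (K : ℝ)
  have ho : Integrable (fun ω => ∑ j ∈ D.filter
      (fun j => meanQuality (quality μ ε) D < quality μ ε j),
      omissionCount α S Y μ ε hKN σ j q ω) P :=
    integrable_finsetSum _ fun j _ => integrable_omissionCount hnet hpol j q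
  have hfc : Integrable (fun ω => K * failureCount α S Y μ ε hKN σ q ω + c) P :=
    hf.add (integrable_const c)
  have hint := integral_mono ((integrable_const _).sub hmeas) (hfc.add ho) hpt
  simp only [Pi.sub_apply, Pi.add_apply] at hint
  rw [integral_sub (integrable_const _) hmeas, integral_add hfc ho,
    integral_add hf (integrable_const c),
    integral_finsetSum _ fun j _ => integrable_omissionCount hnet hpol j q] at hint
  simp only [integral_const, integral_const_mul, probReal_univ, one_smul] at hint
  have h1 := integral_sum_selection_le hnet hpol k t
  have h2 := mul_le_mul_of_nonneg_left (integral_failureCount_le hnet hpol hα hK q)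
    (Nat.cast_nonneg K : (0 : ℝ) ≤ K)
  linarith

lemma sum_circular_le (hD : IsBestSet (quality μ ε) K D)
    (h01 : ∀ n, quality μ ε n ∈ Set.Icc (0 : ℝ) 1) {τ : Equiv.Perm (Fin N)}
    (hτ : IsRanking (quality μ ε) τ) (k : Fin K) (t : ℕ) :
    ∑ m ∈ Finset.range t, quality μ ε (circular hKN τ k m)
      ≤ ((t / K : ℕ) : ℝ) * ∑ n ∈ D, quality μ ε n + K := by
  have hr : ∑ m ∈ Finset.range (t % K), quality μ ε (circular hKN τ k (K * (t / K) + m)) ≤ K := by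
    refine (Finset.sum_le_card_nsmul _ _ 1 fun m _ => (h01 _).2).trans ?_
    rw [Finset.card_range, nsmul_eq_mul, mul_one]
    exact_mod_cast (Nat.mod_lt t k.pos).le
  have hq := sum_circular_rounds hKN (fun _ => τ) k (t / K) (quality μ ε)
  simp only [hD.topSet_eq hKN hτ, Finset.sum_const, Finset.card_range, nsmul_eq_mul] at hq
  calc ∑ m ∈ Finset.range t, quality μ ε (circular hKN τ k m)
      = ∑ m ∈ Finset.range (K * (t / K) + t % K), quality μ ε (circular hKN τ k m) := by
        rw [Nat.div_add_mod]
    _ ≤ _ := by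
        rw [Finset.sum_range_add, hq]
        linarith

lemma mul_meanQuality_le (hD : IsBestSet (quality μ ε) K D) (hK : 0 < K)
    (h01 : ∀ n, quality μ ε n ∈ Set.Icc (0 : ℝ) 1) (t : ℕ) :
    (t : ℝ) * meanQuality (quality μ ε) D
      ≤ ((t / K : ℕ) : ℝ) * ∑ n ∈ D, quality μ ε n + K := by
  have h1 : meanQuality (quality μ ε) D ≤ 1 := hD.meanQuality_le hK fun j _ => (h01 j).2
  have ht : (t : ℝ) = K * (t / K : ℕ) + (t % K : ℕ) := by exact_mod_cast (Nat.div_add_mod t K).symm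
  have hr : ((t % K : ℕ) : ℝ) ≤ K := by exact_mod_cast (Nat.mod_lt t hK).le
  rw [← hD.mul_meanQuality hK]
  have h2 : ((t % K : ℕ) : ℝ) * meanQuality (quality μ ε) D ≤ (t % K : ℕ) :=
    mul_le_of_le_one_right (Nat.cast_nonneg _) h1
  have h3 : (t : ℝ) * meanQuality (quality μ ε) D
      = (t / K : ℕ) * (K * meanQuality (quality μ ε) D)
        + (t % K : ℕ) * meanQuality (quality μ ε) D := by
    rw [ht]
    ring
  linarith

lemma log_round_le (hK : 0 < K) (t : ℕ) :
    Real.log ((K * (t / K) : ℕ) : ℝ) ≤ Real.log ((t : ℝ) + K - 1) := by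
  have h : (t : ℝ) + K - 1 = ((t + (K - 1) : ℕ) : ℝ) := by
    push_cast [Nat.cast_sub hK]
    ring
  rw [h]
  rcases Nat.eq_zero_or_pos (K * (t / K)) with h0 | h0
  · rw [h0, Nat.cast_zero, Real.log_zero]
    exact Real.log_natCast_nonneg _
  · refine Real.log_le_log (by exact_mod_cast h0) ?_
    exact_mod_cast (Nat.mul_div_le t K).trans (Nat.le_add_right _ _)

lemma isBigO_log_round (K : ℕ) :
    (fun t : ℕ => Real.log ((K * (t / K) : ℕ) : ℝ)) =O[atTop] fun t : ℕ => Real.log (t : ℝ) := by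
  refine IsBigO.of_bound 1 (Eventually.of_forall fun t => ?_)
  rw [Real.norm_of_nonneg (Real.log_natCast_nonneg _),
    Real.norm_of_nonneg (Real.log_natCast_nonneg _), one_mul]
  rcases Nat.eq_zero_or_pos (K * (t / K)) with h0 | h0
  · rw [h0, Nat.cast_zero, Real.log_zero]
    exact Real.log_natCast_nonneg _
  · refine Real.log_le_log (by exact_mod_cast h0) ?_
    exact_mod_cast Nat.mul_div_le t K

end Main

end OSA

theorem theorem1 {Ω : Type*} {mΩ : MeasurableSpace Ω} (P : Measure Ω) [IsProbabilityMeasure P]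
    (ℱ : Filtration ℕ mΩ) (N K : ℕ) (hK : 1 ≤ K) (hKN : K ≤ N)
    (S : Fin N → ℕ → Ω → Fin 2) (Y : Fin K → Fin N → ℕ → Ω → Fin 2) (μ ε δ : Fin N → ℝ)
    (hnet : OSA.IsSymmetricNetwork P ℱ S Y μ ε δ)
    (α : ℝ) (hα : 1 < α) (σ : ℕ → Ω → Equiv.Perm (Fin N))
    (hpol : OSA.IsRoundRobinUCB ℱ S Y hKN α σ)
    (D : Finset (Fin N)) (hD : OSA.IsBestSet (OSA.quality μ ε) K D)
    (τ : Equiv.Perm (Fin N)) (hτ : OSA.IsRanking (OSA.quality μ ε) τ) (k : Fin K) :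
    ∃ f : ℕ → ℝ, f =o[atTop] (fun t : ℕ => Real.log (t : ℝ)) ∧
      ∀ t : ℕ,
        OSA.regret P S Y hKN σ (OSA.quality μ ε) τ k t
          ≤ OSA.leadingTerm (OSA.quality μ ε) D K α t + f t ∧
        (t : ℝ) * OSA.meanQuality (OSA.quality μ ε) D - OSA.expectedThroughput P S Y hKN σ k t
          ≤ OSA.leadingTerm (OSA.quality μ ε) D K α t + f t := by
  classical
  have hK0 : 0 < K := hK
  have hK' : (0 : ℝ) < K := by exact_mod_cast hK0
  set lam := OSA.quality μ ε with hlam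
  -- The three terms pay for the incomplete last round, for the rounds outside the confidence
  -- bounds, and for the `+ 1` in each count of wrong selections.
  set c : ℝ := K + K * ∑' m : ℕ, 2 * (N : ℝ) * (m : ℝ) ^ (1 - 2 * α)
    + ∑ n ∈ Dᶜ, (OSA.meanQuality lam D - lam n) with hc
  set f : ℕ → ℝ := fun t => c + ∑ j ∈ D.filter (fun j => OSA.meanQuality lam D < lam j),
    ∫ ω, OSA.omissionCount α S Y μ ε hKN σ j (t / K) ω ∂P with hf
  -- Both benchmarks exceed that of the complete rounds by at most `K`, so this one estimate yields
  -- both claims.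
  have hlead : ∀ t : ℕ, ((t / K : ℕ) : ℝ) * ∑ n ∈ D, lam n
      - OSA.expectedThroughput P S Y hKN σ k t + K ≤ OSA.leadingTerm lam D K α t + f t := by
    intro t
    have h := OSA.integral_loss_le hnet hpol hα hK0 hD k t
    have hsum : ∑ n ∈ Dᶜ, (OSA.meanQuality lam D - lam n)
          * (4 * α * Real.log ((K * (t / K) : ℕ) : ℝ) / (K * OSA.gap lam D n ^ 2) + 1)
        ≤ OSA.leadingTerm lam D K α t + ∑ n ∈ Dᶜ, (OSA.meanQuality lam D - lam n) := by
      unfold OSA.leadingTerm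
      rw [← Finset.sum_add_distrib]
      refine Finset.sum_le_sum fun n hn => ?_
      have hnD := Finset.mem_compl.1 hn
      have hg := hD.gap_pos hK0 hnD
      have hm : 0 ≤ OSA.meanQuality lam D - lam n :=
        sub_nonneg.2 (hD.le_meanQuality hK0 fun j hj => (hD.2 n hnD j hj).le)
      have hcoef : 0 ≤ 4 * α * (OSA.meanQuality lam D - lam n) / (K * OSA.gap lam D n ^ 2) := by
        have : 0 ≤ 4 * α := by linarith
        positivity
      calc (OSA.meanQuality lam D - lam n)
            * (4 * α * Real.log ((K * (t / K) : ℕ) : ℝ) / (K * OSA.gap lam D n ^ 2) + 1)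
          = 4 * α * (OSA.meanQuality lam D - lam n) / (K * OSA.gap lam D n ^ 2)
            * Real.log ((K * (t / K) : ℕ) : ℝ) + (OSA.meanQuality lam D - lam n) := by ring
        _ ≤ _ := by
          have := mul_le_mul_of_nonneg_left (OSA.log_round_le hK0 t) hcoef
          linarith
    simp only [hf, hc]
    linarith
  refine ⟨f, ?_, fun t => ⟨?_, ?_⟩⟩
  · refine IsLittleO.add ?_ (IsLittleO.fun_sum fun j hj => ?_)
    · exact isLittleO_const_left.2 (Or.inr (tendsto_norm_atTop_atTop.comp
        (Real.tendsto_log_atTop.comp tendsto_natCast_atTop_atTop)))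
    · rw [Finset.mem_filter] at hj
      exact ((OSA.isLittleO_integral_omissionCount hnet hpol hα hK0 hD hj.1 hj.2).comp_tendsto
        (Nat.tendsto_div_const_atTop hK0.ne')).trans_isBigO (OSA.isBigO_log_round K)
  · refine le_trans ?_ (hlead t)
    unfold OSA.regret
    linarith [OSA.sum_circular_le (hKN := hKN) hD hnet.quality_mem_Icc hτ k t]
  · refine le_trans ?_ (hlead t)
    linarith [OSA.mul_meanQuality_le hD hK0 hnet.quality_mem_Icc t]
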